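/- Let $n\ge 1$, let $\mathbb F_n$ be the free group on $g_1,\dots,g_n$ with word length $|\cdot|$, let $\lambda$ be its left regular representation on $\ell_2(\mathbb F_n)$, $\lambda_g f(h)=f(g^{-1}h)$, and let $\widehat{\mathbb F}_n$ be the von Neumann algebra generated by $\{\lambda_g: g\in\mathbb F_n\}$, with canonical tracial state $\tau(x)=\langle x\delta_e,\delta_e\rangle$. For $x\in\widehat{\mathbb F}_n$ put $\|x\|_p=\tau\big((x^*x)^{p/2}\big)^{1/p}$ for $1\le p<\infty$, and let $\|x\|_\infty$ be the operator norm. A polynomial is a finite sum $x=\sum_g x_g\lambda_g$ with $x_g\in\mathbb C$; on polynomials let $L(x)=\sum_g |g|\,x_g\lambda_g$ and $P_t(x)=\sum_g e^{-t|g|}x_g\lambda_g$ for $t\ge 0$. For $d\ge 0$ let $\mathcal P^{\ge d}$ (resp. $\mathcal P^{\le d}$) be the complex linear span of $\{\lambda_g:|g|\ge d\}$ (resp. $\{\lambda_g:|g|\le d\}$). A polynomial is holomorphic if it lies in the linear span of $\{\lambda_g: g\in\mathbb F_n^+\}$, where $\mathbb F_n^+$ is the unital sub-semigroup (submonoid)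 of $\mathbb F_n$ generated by $g_1,\dots,g_n$. Then for every $d\ge 1$, every $1\le p\le\infty$ and every holomorphic polynomial $x$: (i) if $x\in\mathcal P^{\ge d}$, then $\|P_t(x)\|_p\le e^{-td}\|x\|_p$ for all $t\ge 0$, and $\|L(x)\|_p\ge d\,\|x\|_p$; (ii) if $x\in\mathcal P^{\le d}$, then $\|L(x)\|_p\le d\,\|x\|_p$, and $\|P_t(x)\|_p\ge e^{-td}\|x\|_p$ for all $t\ge 0$. These bounds are sharp: for every $n\ge1$ and $d\ge 1$ there is a holomorphic polynomial $x\in\mathcal P^{\ge d}\cap\mathcal P^{\le d}$ such that, for all $1\le p\le\infty$, $\|x\|_p>0$, $\|P_t(x)\|_p= e^{-td}\|x\|_p$ for all $t\ge 0$, and $\|L(x)\|_p= d\,\|x\|_p$. -/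

import Mathlib

open scoped ENNReal

noncomputable section

namespace FreeHeat

/-! ### The left regular representation and the group von Neumann algebra -/

section Group

variable (G : Type) [Group G]

/-- The Hilbert space `ℓ²(G)` of square-summable complex functions on the group `G`. -/
abbrev EllTwo : Type := lp (fun _ : G => ℂ) 2

variable {G}

/-- Left translation `f ↦ f (g⁻¹ ·)` preserves square-summability. -/
theorem memℓp_translate (g : G) (f : EllTwo G) :
    Memℓp (fun h : G => (f : G → ℂ) (g⁻¹ * h)) 2 := by
  have hf := lp.memℓp f
  rw [memℓp_gen_iff (by norm_num)] at hf ⊢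
  exact hf.comp_injective (mul_right_injective g⁻¹)

/-- Left translation by `g` as a linear isometry of `ℓ²(G)`. -/
def translate (g : G) : EllTwo G →ₗᵢ[ℂ] EllTwo G where
  toFun f := ⟨fun h => (f : G → ℂ) (g⁻¹ * h), memℓp_translate g f⟩
  map_add' _ _ := rfl
  map_smul' _ _ := rfl
  norm_map' f := by
    rw [lp.norm_eq_tsum_rpow (by norm_num), lp.norm_eq_tsum_rpow (by norm_num)]
    congr 1
    exact (Equiv.mulLeft g⁻¹).tsum_eq (fun h : G => ‖(f : G → ℂ) h‖ ^ (2 : ℝ≥0∞).toReal)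

/-- The left regular representation `λ`: the operator `(λ_g f)(h) = f (g⁻¹ h)` on `ℓ²(G)`. -/
def leftReg (g : G) : EllTwo G →L[ℂ] EllTwo G := (translate g).toContinuousLinearMap

@[simp]
theorem leftReg_apply (g : G) (f : EllTwo G) (h : G) : leftReg g f h = f (g⁻¹ * h) := rfl

/-- The basis vector `δ_e` of `ℓ²(G)`. -/
def deltaOne : EllTwo G :=
  haveI := Classical.decEq G
  lp.single 2 (1 : G) (1 : ℂ)

theorem leftReg_deltaOne [DecidableEq G] (g h : G) :
    leftReg g (deltaOne : EllTwo G) h = if h = g then 1 else 0 := by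
  classical
  rw [leftReg_apply, deltaOne]
  by_cases hg : h = g
  · subst hg
    simp
  · have h1 : g⁻¹ * h ≠ 1 := fun h0 => hg (inv_mul_eq_one.mp h0).symm
    simp [h1, hg]

variable (G)

/-- The von Neumann algebra on `ℓ²(G)` generated by the operators `λ_g`: the double commutant of
`{λ_g | g ∈ G}`. -/
def groupVNAlg : VonNeumannAlgebra (EllTwo G) where
  toStarSubalgebra :=
    StarSubalgebra.centralizer ℂ
      (StarSubalgebra.centralizer ℂ (Set.range (leftReg (G := G))) : Set (EllTwo G →L[ℂ] EllTwo G))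
  centralizer_centralizer' := by
    change Set.centralizer (Set.centralizer
      ((StarSubalgebra.centralizer ℂ (StarSubalgebra.centralizer ℂ
        (Set.range (leftReg (G := G))) : Set (EllTwo G →L[ℂ] EllTwo G)) :
        StarSubalgebra ℂ (EllTwo G →L[ℂ] EllTwo G)) : Set (EllTwo G →L[ℂ] EllTwo G))) =
      ((StarSubalgebra.centralizer ℂ (StarSubalgebra.centralizer ℂ
        (Set.range (leftReg (G := G))) : Set (EllTwo G →L[ℂ] EllTwo G)) :
        StarSubalgebra ℂ (EllTwo G →L[ℂ] EllTwo G)) : Set (EllTwo G →L[ℂ] EllTwo G))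
    rw [StarSubalgebra.coe_centralizer_centralizer]
    exact congrArg _ (Set.centralizer_centralizer_centralizer _)

/-- The elements of the group von Neumann algebra of `G`. -/
abbrev GroupVN : Type := (groupVNAlg G).toStarSubalgebra

instance groupVN_isClosed :
    IsClosed ((groupVNAlg G).toStarSubalgebra : Set (EllTwo G →L[ℂ] EllTwo G)) :=
  Set.isClosed_centralizer _

variable {G}

theorem leftReg_mem (g : G) : leftReg g ∈ (groupVNAlg G).toStarSubalgebra := by
  change leftReg g ∈ StarSubalgebra.centralizer ℂ
      (StarSubalgebra.centralizer ℂ (Set.range (leftReg (G := G))) : Set (EllTwo G →L[ℂ] EllTwo G))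
  exact StarAlgebra.adjoin_le_centralizer_centralizer ℂ _
    (StarAlgebra.subset_adjoin ℂ _ ⟨g, rfl⟩)

/-- `λ_g` as an element of the group von Neumann algebra. -/
def lam (g : G) : GroupVN G := ⟨leftReg g, leftReg_mem g⟩

/-- The canonical tracial state `τ(x) = ⟨x δ_e, δ_e⟩` (Mathlib's inner product is linear in its
second argument). -/
def tau (x : GroupVN G) : ℂ :=
  inner ℂ (deltaOne : EllTwo G) ((x : EllTwo G →L[ℂ] EllTwo G) deltaOne)

/-- The norm of the noncommutative `L_p` space of the group von Neumann algebra, on elements of the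
algebra: `‖x‖_p = τ((x* x)^{p/2})^{1/p}` for finite `p`, where the power is taken by continuous
functional calculus, and the operator norm for `p = ∞`. -/
def normLp (p : ℝ≥0∞) (x : GroupVN G) : ℝ :=
  if p = ∞ then ‖x‖
  else (tau (cfc (fun s : ℝ => s ^ (p.toReal / 2)) (star x * x))).re ^ (1 / p.toReal)

theorem linearIndependent_lam : LinearIndependent ℂ (lam : G → GroupVN G) := by
  classical
  rw [linearIndependent_iff']
  intro s c hc g hg
  have h1 : ((∑ i ∈ s, c i • lam i : GroupVN G) : EllTwo G →L[ℂ] EllTwo G) = 0 := by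
    rw [hc]; rfl
  have h2 : ∑ i ∈ s, c i • leftReg i = (0 : EllTwo G →L[ℂ] EllTwo G) := by
    rw [← h1]; simp [lam]
  have h3 := congrArg (fun T : EllTwo G →L[ℂ] EllTwo G => T deltaOne g) h2
  simp only [sum_apply, smul_apply, lp.coeFn_sum,
    Finset.sum_apply, lp.coeFn_smul, Pi.smul_apply, leftReg_deltaOne] at h3
  simpa [hg] using h3

variable (G)

/-- The space of polynomials, i.e. finite linear combinations of the `λ_g`. -/
abbrev Poly : Type := Submodule.span ℂ (Set.range (lam : G → GroupVN G))

variable {G}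

/-- The `λ_g` form a basis of the space of polynomials. -/
def polyBasis : Module.Basis G ℂ (Poly G) := Module.Basis.span linearIndependent_lam

theorem coe_polyBasis (g : G) : (polyBasis g : GroupVN G) = lam g :=
  Module.Basis.coe_span_apply _ _

end Group

/-! ### Free groups -/

variable {n : ℕ}

/-- The generator `L` on polynomials: `L(∑ x_g λ_g) = ∑ |g| x_g λ_g`, with `|g|` the word length. -/
def gen : Poly (FreeGroup (Fin n)) →ₗ[ℂ] Poly (FreeGroup (Fin n)) :=
  polyBasis.constr ℂ fun g => (g.norm : ℂ) • polyBasis g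

/-- The semigroup `P_t = e^{-tL}` on polynomials: `P_t(∑ x_g λ_g) = ∑ e^{-t|g|} x_g λ_g`. -/
def heat (t : ℝ) : Poly (FreeGroup (Fin n)) →ₗ[ℂ] Poly (FreeGroup (Fin n)) :=
  polyBasis.constr ℂ fun g => (Real.exp (-t * g.norm) : ℂ) • polyBasis g

variable (n)

/-- The positive semigroup generated by the generators of the free group (including `e`). -/
def posSemigroup : Submonoid (FreeGroup (Fin n)) :=
  Submonoid.closure (Set.range FreeGroup.of)

/-- The holomorphic polynomials: the linear span of the `λ_g` with `g` in the positive semigroup. -/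
def holomorphic : Submodule ℂ (Poly (FreeGroup (Fin n))) :=
  Submodule.span ℂ (polyBasis '' {g | g ∈ posSemigroup n})

/-- The tail space: the linear span of the `λ_g` with `|g| ≥ d`. -/
def tailSpace (d : ℕ) : Submodule ℂ (Poly (FreeGroup (Fin n))) :=
  Submodule.span ℂ (polyBasis '' {g | d ≤ g.norm})

/-- The low-degree space: the linear span of the `λ_g` with `|g| ≤ d`. -/
def lowSpace (d : ℕ) : Submodule ℂ (Poly (FreeGroup (Fin n))) :=
  Submodule.span ℂ (polyBasis '' {g | g.norm ≤ d})

end FreeHeat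

end

/-!
On positive words of the free group there is no cancellation, so the word length is additive there
and agrees with the homomorphism to `ℤ` sending every generator to `1`. Hence, for `|z| = 1`, the
rotation `∑ x_g λ_g ↦ ∑ z^|g| x_g λ_g` of holomorphic polynomials is conjugation by the diagonal
unitary of a character of the free group (`coe_degMul_pow_of_holomorphic`), and it preserves all the
norms `‖·‖_p` (`normLp_degMul_pow`). By the triangle inequality a positive combination of rotations
and phases has norm at most its total weight (`normLp_degMul_sum_le`).

A nonnegative, decreasing, convex sequence `ψ` is a positive combination of the triangles
`j ↦ (m - j)₊` and of a constant, by two summations by parts; a triangle is a positive combination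
of characters, because the Fejér kernel is nonnegative. On polynomials of degree at least `d` the
multiplier `ψ(|g| - d)` therefore has norm at most `ψ(0)` (`normLp_degMul_le_of_tail`), and on
polynomials of degree at most `d` so does `ψ(d - |g|)` (`normLp_degMul_le_of_low`). The choices
`e^{-tj}`, `1 / (d + j)` and `(d - j)₊` of `ψ` give the four estimates, the lower bounds being upper
bounds for the inverse multipliers. Equality holds at `λ_g` for a positive word `g` of length `d`.

The triangle inequality for `‖x‖_p = τ((x⋆ x)^{p/2})^{1/p}` is proved for a positive trace on a
C⋆-algebra. The tool is `IsPosTrace.re_cfc_add_re_cfc_mul_le`: an inequality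
`u(t) + v(t) s ≤ F(s)` between functions on the spectra of `a` and `b` holds under the trace, for
noncommuting `a` and `b`. Partitioning unity on the spectrum of `b` by Bernstein polynomials reduces
it to `τ(h(b) k(a)) ≥ 0` for `h, k ≥ 0`. With `q = p / 2` this gives Jensen's inequality for
`τ(a ^ q)` when `q ≥ 1`; with `(s x + t y)⋆ (s x + t y) ≤ s x⋆ x + t y⋆ y` this settles `p ≥ 2`. For
`1 ≤ p < 2` it shows that `τ((x⋆ x)^q)` is the infimum over `b > 0` of
`q τ(b⁻¹ x⋆ x) + (1 - q) τ(b^{q / (1 - q)})`, which is jointly convex in `(x, b)`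
(`IsPosTrace.trace_star_mul_self_rpow_convex`).
-/

noncomputable section

namespace FreeHeat

open Filter Topology Set

/-! ### Two-variable trace inequalities -/

/-- The `k`-th Bernstein polynomial of order `m`, transported from `[0, 1]` to `[lo, hi]`. -/
def bernsteinOn (lo hi : ℝ) (m k : ℕ) (t : ℝ) : ℝ :=
  (m.choose k : ℝ) * ((t - lo) / (hi - lo)) ^ k * (1 - (t - lo) / (hi - lo)) ^ (m - k)

/-- The `k`-th of the `m + 1` equally spaced nodes of `[lo, hi]`. -/
def bernsteinNode (lo hi : ℝ) (m k : ℕ) : ℝ := lo + (hi - lo) * ((k : ℝ) / m)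

section Bernstein

variable {lo hi : ℝ}

theorem rescale_mem_unitInterval (h : lo < hi) {t : ℝ} (ht : t ∈ Icc lo hi) :
    (t - lo) / (hi - lo) ∈ unitInterval := by
  have h0 : 0 < hi - lo := sub_pos.2 h
  exact ⟨div_nonneg (sub_nonneg.2 ht.1) h0.le, (div_le_one h0).2 (by linarith [ht.2])⟩

theorem bernsteinOn_eq (h : lo < hi) (m k : ℕ) {t : ℝ} (ht : t ∈ Icc lo hi) :
    bernsteinOn lo hi m k t = bernstein m k ⟨_, rescale_mem_unitInterval h ht⟩ := by
  rw [bernstein_apply, bernsteinOn]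

theorem bernsteinOn_nonneg (h : lo < hi) (m k : ℕ) {t : ℝ} (ht : t ∈ Icc lo hi) :
    0 ≤ bernsteinOn lo hi m k t := by
  rw [bernsteinOn_eq h m k ht]
  exact bernstein_nonneg

theorem sum_bernsteinOn (h : lo < hi) (m : ℕ) {t : ℝ} (ht : t ∈ Icc lo hi) :
    ∑ k : Fin (m + 1), bernsteinOn lo hi m k t = 1 := by
  simp_rw [bernsteinOn_eq h m _ ht]
  exact bernstein.probability m _

theorem continuous_bernsteinOn (lo hi : ℝ) (m k : ℕ) : Continuous (bernsteinOn lo hi m k) := by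
  unfold bernsteinOn
  fun_prop

theorem affine_mem_Icc (h : lo < hi) {x : ℝ} (hx : x ∈ unitInterval) :
    lo + (hi - lo) * x ∈ Icc lo hi := by
  have h0 : 0 < hi - lo := sub_pos.2 h
  constructor <;> nlinarith [hx.1, hx.2]

theorem bernsteinNode_mem (h : lo < hi) (m : ℕ) (k : Fin (m + 1)) :
    bernsteinNode lo hi m k ∈ Icc lo hi :=
  affine_mem_Icc h (bernstein.z k).2

theorem tendstoUniformlyOn_bernsteinOn (h : lo < hi) {u : ℝ → ℝ}
    (hu : ContinuousOn u (Icc lo hi)) :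
    TendstoUniformlyOn
      (fun (m : ℕ) t => ∑ k : Fin (m + 1), bernsteinOn lo hi m k t * u (bernsteinNode lo hi m k))
      u atTop (Icc lo hi) := by
  let f : C(unitInterval, ℝ) := ⟨fun x => u (lo + (hi - lo) * x),
    hu.comp_continuous (by fun_prop) fun x => affine_mem_Icc h x.2⟩
  have hf := ContinuousMap.tendsto_iff_tendstoUniformly.1 (bernsteinApproximation_uniform f)
  rw [Metric.tendstoUniformly_iff] at hf
  rw [Metric.tendstoUniformlyOn_iff]
  intro ε hε
  filter_upwards [hf ε hε] with m hm t ht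
  have h0 : hi - lo ≠ 0 := (sub_pos.2 h).ne'
  have h1 := hm ⟨_, rescale_mem_unitInterval h ht⟩
  have h2 : lo + (hi - lo) * ((t - lo) / (hi - lo)) = t := by field_simp; ring
  simp only [f, ContinuousMap.coe_mk, h2, bernsteinApproximation, ContinuousMap.sum_apply,
    smul_eq_mul] at h1
  simp_rw [bernsteinOn_eq h m _ ht]
  exact h1

end Bernstein

section Trace

variable {A : Type*} [CStarAlgebra A]

/-- A bounded positive trace on a C⋆-algebra. -/
structure IsPosTrace (τ : A →L[ℂ] ℂ) : Prop where
  re_star_mul_self_nonneg : ∀ y, 0 ≤ (τ (star y * y)).re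
  map_mul_comm : ∀ x y, τ (x * y) = τ (y * x)

variable {τ : A →L[ℂ] ℂ}

/-- Traciality turns `τ (r² s²)`, with `r = √h(b)` and `s = √k(a)`, into `τ ((r s)⋆ (r s))`. -/
theorem IsPosTrace.re_cfc_mul_cfc_nonneg (hτ : IsPosTrace τ) {a b : A} {h k : ℝ → ℝ}
    (hh : ContinuousOn h (spectrum ℝ b)) (hk : ContinuousOn k (spectrum ℝ a))
    (hh0 : ∀ t ∈ spectrum ℝ b, 0 ≤ h t) (hk0 : ∀ t ∈ spectrum ℝ a, 0 ≤ k t) :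
    0 ≤ (τ (cfc h b * cfc k a)).re := by
  have sq {c : A} {f : ℝ → ℝ} (hf : ContinuousOn f (spectrum ℝ c))
      (hf0 : ∀ t ∈ spectrum ℝ c, 0 ≤ f t) :
      cfc f c = cfc (fun t => √(f t)) c * cfc (fun t => √(f t)) c := by
    rw [← cfc_mul _ _ c hf.sqrt hf.sqrt]
    exact cfc_congr fun t ht => (Real.mul_self_sqrt (hf0 t ht)).symm
  have h1 := hτ.re_star_mul_self_nonneg (cfc (fun t => √(h t)) b * cfc (fun t => √(k t)) a)
  rw [star_mul, (cfc_predicate (p := IsSelfAdjoint) _ b).star_eq,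
    (cfc_predicate (p := IsSelfAdjoint) _ a).star_eq, mul_assoc, hτ.map_mul_comm] at h1
  rw [sq hh hh0, sq hk hk0]
  simpa only [mul_assoc] using h1

theorem IsPosTrace.re_cfc_mul_star_mul_self_nonneg (hτ : IsPosTrace τ) {b : A} (y : A) {h : ℝ → ℝ}
    (hh : ContinuousOn h (spectrum ℝ b)) (hh0 : ∀ t ∈ spectrum ℝ b, 0 ≤ h t) :
    0 ≤ (τ (cfc h b * (star y * y))).re := by
  have h1 := hτ.re_cfc_mul_cfc_nonneg (a := star y * y) hh continuousOn_id hh0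
    spectrum_star_mul_self_nonneg
  rwa [cfc_id ℝ (star y * y)] at h1

theorem IsPosTrace.re_cfc_mono (hτ : IsPosTrace τ) {a : A} {f g : ℝ → ℝ}
    (hf : ContinuousOn f (spectrum ℝ a)) (hg : ContinuousOn g (spectrum ℝ a))
    (h : ∀ t ∈ spectrum ℝ a, f t ≤ g t) : (τ (cfc f a)).re ≤ (τ (cfc g a)).re := by
  have h1 := hτ.re_cfc_mul_star_mul_self_nonneg 1 (hg.sub hf) fun t ht => sub_nonneg.2 (h t ht)
  have h2 : cfc (fun t => g t - f t) a = cfc g a - cfc f a := cfc_sub g f a hg hf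
  rw [star_one, mul_one, mul_one] at h1
  change 0 ≤ (τ (cfc (fun t => g t - f t) a)).re at h1
  rw [h2, map_sub, Complex.sub_re] at h1
  linarith

/-- A pointwise inequality `u(t) + v(t) s ≤ F(s)` persists under a trace when `s`, `t` are replaced
by self-adjoint `a`, `b` that need not commute. For a Bernstein partition of unity `h_k` with nodes
`t_k`, it is the limit of `∑ k, τ (h_k(b) (F(a) - u(t_k) - v(t_k) a)) ≥ 0`. -/
theorem IsPosTrace.re_cfc_add_re_cfc_mul_le (hτ : IsPosTrace τ) {a b : A}
    (ha : IsSelfAdjoint a) (hb : IsSelfAdjoint b) {lo hi : ℝ} (hlh : lo < hi)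
    (hspec : spectrum ℝ b ⊆ Icc lo hi) {F u v : ℝ → ℝ} (hF : ContinuousOn F (spectrum ℝ a))
    (hu : ContinuousOn u (Icc lo hi)) (hv : ContinuousOn v (Icc lo hi))
    (h : ∀ s ∈ spectrum ℝ a, ∀ t ∈ Icc lo hi, u t + v t * s ≤ F s) :
    (τ (cfc u b)).re + (τ (cfc v b * a)).re ≤ (τ (cfc F a)).re := by
  -- `B w m` is the Bernstein approximation of order `m` to `w` on `[lo, hi]`.
  let B (w : ℝ → ℝ) (m : ℕ) (t : ℝ) : ℝ :=
    ∑ k : Fin (m + 1), bernsteinOn lo hi m k t * w (bernsteinNode lo hi m k)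
  have hBc (w : ℝ → ℝ) (m : ℕ) : Continuous (B w m) :=
    continuous_finsetSum _ fun k _ => (continuous_bernsteinOn lo hi m k).mul continuous_const
  have lim {w : ℝ → ℝ} (hw : ContinuousOn w (Icc lo hi)) :
      Tendsto (fun m => cfc (B w m) b) atTop (𝓝 (cfc w b)) :=
    tendsto_cfc_fun ((tendstoUniformlyOn_bernsteinOn hlh hw).mono hspec)
      (Eventually.of_forall fun m => (hBc w m).continuousOn)
  have hBsum (w : ℝ → ℝ) (m : ℕ) : cfc (B w m) b =
      ∑ k : Fin (m + 1), (w (bernsteinNode lo hi m k)) • cfc (bernsteinOn lo hi m k) b := by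
    have hc (k : ℕ) : ContinuousOn (bernsteinOn lo hi m k) (spectrum ℝ b) :=
      (continuous_bernsteinOn lo hi m k).continuousOn
    simp_rw [← cfc_const_mul _ _ b (hc _)]
    rw [← cfc_sum_univ _ b fun k => by exact (hc k).const_mul _]
    congr 1
    ext t
    simp [B, mul_comm]
  have key (m : ℕ) : (τ (cfc (B u m) b)).re + (τ (cfc (B v m) b * a)).re ≤ (τ (cfc F a)).re := by
    have h1 : ∑ k : Fin (m + 1), cfc (bernsteinOn lo hi m k) b = 1 := by
      rw [← cfc_sum_univ (fun k : Fin (m + 1) => bernsteinOn lo hi m k) b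
        fun k => (continuous_bernsteinOn lo hi m k).continuousOn,
        ← cfc_one ℝ b]
      refine cfc_congr fun t ht => ?_
      simpa using sum_bernsteinOn hlh m (hspec ht)
    have h2 (k : Fin (m + 1)) : 0 ≤ (τ (cfc (bernsteinOn lo hi m k) b * (cfc F a
        - (algebraMap ℝ A (u (bernsteinNode lo hi m k)) + v (bernsteinNode lo hi m k) • a)))).re := by
      have h3 := hτ.re_cfc_mul_cfc_nonneg (a := a) (b := b) (h := bernsteinOn lo hi m k)
        (k := fun s => F s - (u (bernsteinNode lo hi m k) + v (bernsteinNode lo hi m k) * s))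
        (continuous_bernsteinOn lo hi m k).continuousOn (hF.sub (by fun_prop))
        (fun t ht => bernsteinOn_nonneg hlh m k (hspec ht))
        (fun s hs => sub_nonneg.2 (h s hs _ (bernsteinNode_mem hlh m k)))
      rwa [cfc_sub F _ a hF (by fun_prop), cfc_const_add _ _ a, cfc_const_mul_id _ a] at h3
    have h4 := Finset.sum_nonneg fun k (_ : k ∈ Finset.univ) => h2 k
    rw [← Complex.re_sum, ← map_sum] at h4
    have h5 : ∑ k : Fin (m + 1), cfc (bernsteinOn lo hi m k) b * (cfc F a
        - (algebraMap ℝ A (u (bernsteinNode lo hi m k)) + v (bernsteinNode lo hi m k) • a))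
        = cfc F a - (cfc (B u m) b + cfc (B v m) b * a) := by
      rw [hBsum, hBsum, Finset.sum_mul, ← Finset.sum_add_distrib]
      conv_rhs => rw [← one_mul (cfc F a), ← h1, Finset.sum_mul]
      rw [← Finset.sum_sub_distrib]
      refine Finset.sum_congr rfl fun k _ => ?_
      simp [mul_sub, mul_add, Algebra.algebraMap_eq_smul_one]
    rw [h5] at h4
    simp only [map_sub, map_add, Complex.sub_re, Complex.add_re] at h4
    linarith
  have hl : Tendsto (fun m => (τ (cfc (B u m) b)).re + (τ (cfc (B v m) b * a)).re) atTop
      (𝓝 ((τ (cfc u b)).re + (τ (cfc v b * a)).re)) := by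
    have hre : Continuous fun x : A => (τ x).re := Complex.continuous_re.comp τ.continuous
    exact ((hre.tendsto _).comp (lim hu)).add ((hre.tendsto _).comp ((lim hv).mul_const a))
  exact le_of_tendsto' hl key

/-! ### Convexity of `x ↦ τ ((x⋆ x) ^ q)` -/

/-- The convex function `s ↦ s ^ q` lies above its tangent at `t`; the form with weighted
arithmetic and geometric means also covers `t = 0`. -/
theorem rpow_tangent_le {q s t : ℝ} (hq : 1 ≤ q) (hs : 0 ≤ s) (ht : 0 ≤ t) :
    (1 - q) * t ^ q + q * t ^ (q - 1) * s ≤ s ^ q := by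
  have hq0 : 0 < q := by linarith
  have h := Real.geom_mean_le_arith_mean2_weighted (w₁ := q⁻¹) (w₂ := 1 - q⁻¹)
    (inv_nonneg.2 hq0.le) (sub_nonneg.2 (inv_le_one_of_one_le₀ hq)) (Real.rpow_nonneg hs q)
    (Real.rpow_nonneg ht q) (by ring)
  rw [Real.rpow_rpow_inv hs hq0.ne', ← Real.rpow_mul ht,
    show q * (1 - q⁻¹) = q - 1 by field_simp] at h
  have h2 := mul_le_mul_of_nonneg_left h hq0.le
  have h3 : q * (q⁻¹ * s ^ q + (1 - q⁻¹) * t ^ q) = s ^ q + (q - 1) * t ^ q := by field_simp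
  linarith

theorem rpow_le_variational {q s t : ℝ} (hq0 : 0 ≤ q) (hq1 : q < 1) (hs : 0 ≤ s) (ht : 0 < t) :
    s ^ q ≤ q * t⁻¹ * s + (1 - q) * t ^ (q / (1 - q)) := by
  have h1 : 0 < 1 - q := sub_pos.2 hq1
  have h := Real.geom_mean_le_arith_mean2_weighted (w₁ := q) (w₂ := 1 - q) hq0 h1.le
    (mul_nonneg hs (inv_nonneg.2 ht.le)) (Real.rpow_nonneg ht.le (q / (1 - q))) (by ring)
  rw [Real.mul_rpow hs (inv_nonneg.2 ht.le), ← Real.rpow_mul ht.le, div_mul_cancel₀ _ h1.ne',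
    Real.inv_rpow ht.le, mul_assoc, inv_mul_cancel₀ (Real.rpow_pos_of_pos ht q).ne', mul_one] at h
  linarith

theorem re_map_smul (τ : A →L[ℂ] ℂ) (c : ℝ) (a : A) : (τ (c • a)).re = c * (τ a).re := by
  simp [τ.map_smul_of_tower c a]

theorem cfc_mul_self {f : ℝ → ℝ} {b : A} (hb : IsSelfAdjoint b)
    (hf : ContinuousOn f (spectrum ℝ b)) : cfc f b * b = cfc (fun t => f t * t) b := by
  rw [cfc_mul f (fun t => t) b hf (by fun_prop), cfc_id' ℝ b]

theorem spectrum_subset_Icc_of_nonneg {b : A} (h : ∀ t ∈ spectrum ℝ b, 0 ≤ t) :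
    spectrum ℝ b ⊆ Icc 0 (‖b‖ + 1) := by
  intro t ht
  refine ⟨h t ht, ?_⟩
  rcases subsingleton_or_nontrivial A with hA | hA
  · simp [spectrum.of_subsingleton] at ht
  · linarith [spectrum.norm_le_norm_of_mem ht, Real.le_norm_self t]


/-- The tangent line inequality `(1 - q) t ^ q + q t ^ (q - 1) s ≤ s ^ q` under a trace. -/
theorem IsPosTrace.trace_rpow_tangent_le (hτ : IsPosTrace τ) {a b : A} (ha : IsSelfAdjoint a)
    (hb : IsSelfAdjoint b) (ha0 : ∀ t ∈ spectrum ℝ a, 0 ≤ t) (hb0 : ∀ t ∈ spectrum ℝ b, 0 ≤ t)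
    {q : ℝ} (hq : 1 ≤ q) :
    (1 - q) * (τ (cfc (fun t : ℝ => t ^ q) b)).re
      + q * (τ (cfc (fun t : ℝ => t ^ (q - 1)) b * a)).re ≤
      (τ (cfc (fun t : ℝ => t ^ q) a)).re := by
  have c1 : Continuous fun t : ℝ => t ^ q := Real.continuous_rpow_const (by linarith)
  have c2 : Continuous fun t : ℝ => t ^ (q - 1) := Real.continuous_rpow_const (by linarith)
  have h := hτ.re_cfc_add_re_cfc_mul_le ha hb (by positivity : (0 : ℝ) < ‖b‖ + 1)
    (spectrum_subset_Icc_of_nonneg hb0) (F := fun t => t ^ q) (u := fun t => (1 - q) * t ^ q)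
    (v := fun t => q * t ^ (q - 1)) c1.continuousOn (c1.const_mul _).continuousOn
    (c2.const_mul _).continuousOn fun s hs t ht => rpow_tangent_le hq (ha0 s hs) ht.1
  rw [cfc_const_mul _ _ b c1.continuousOn, cfc_const_mul _ _ b c2.continuousOn] at h
  simpa using h

/-- Jensen's inequality for a trace: if `b` is dominated under the trace by the convex combination
`s • a₁ + t • a₂`, then `τ (b ^ q) ≤ s τ (a₁ ^ q) + t τ (a₂ ^ q)`. -/
theorem IsPosTrace.trace_rpow_le (hτ : IsPosTrace τ) {a₁ a₂ b : A} (ha₁ : IsSelfAdjoint a₁)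
    (ha₂ : IsSelfAdjoint a₂) (hb : IsSelfAdjoint b) (ha₁0 : ∀ t ∈ spectrum ℝ a₁, 0 ≤ t)
    (ha₂0 : ∀ t ∈ spectrum ℝ a₂, 0 ≤ t) (hb0 : ∀ t ∈ spectrum ℝ b, 0 ≤ t) {s t : ℝ} (hs : 0 ≤ s)
    (ht : 0 ≤ t) (hst : s + t = 1) {q : ℝ} (hq : 1 ≤ q)
    (hdom : 0 ≤ (τ (cfc (fun t : ℝ => t ^ (q - 1)) b * (s • a₁ + t • a₂ - b))).re) :
    (τ (cfc (fun t : ℝ => t ^ q) b)).re ≤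
      s * (τ (cfc (fun t : ℝ => t ^ q) a₁)).re + t * (τ (cfc (fun t : ℝ => t ^ q) a₂)).re := by
  have h1 := mul_le_mul_of_nonneg_left (hτ.trace_rpow_tangent_le ha₁ hb ha₁0 hb0 hq) hs
  have h2 := mul_le_mul_of_nonneg_left (hτ.trace_rpow_tangent_le ha₂ hb ha₂0 hb0 hq) ht
  have h3 : cfc (fun t : ℝ => t ^ (q - 1)) b * b = cfc (fun t : ℝ => t ^ q) b := by
    rw [cfc_mul_self hb (Real.continuous_rpow_const (by linarith)).continuousOn]
    refine cfc_congr fun t ht => ?_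
    rcases (hb0 t ht).eq_or_lt with h0 | h0
    · simp [← h0, Real.zero_rpow (by linarith : q ≠ 0)]
    · simp [Real.rpow_sub_one h0.ne', h0.ne']
  rw [mul_sub, mul_add, mul_smul_comm, mul_smul_comm, h3] at hdom
  simp only [map_sub, map_add, Complex.sub_re, Complex.add_re, re_map_smul] at hdom
  have h4 := mul_le_mul_of_nonneg_left hdom (by linarith : 0 ≤ q)
  obtain rfl : t = 1 - s := by linarith
  linarith

theorem cfc_inv_mul_self {b : A} (hb : IsSelfAdjoint b) (hb0 : ∀ t ∈ spectrum ℝ b, 0 < t) :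
    cfc (fun t : ℝ => t⁻¹) b * b = 1 ∧ b * cfc (fun t : ℝ => t⁻¹) b = 1 := by
  have hc : ContinuousOn (fun t : ℝ => t⁻¹) (spectrum ℝ b) :=
    continuousOn_inv₀.mono fun t ht => (hb0 t ht).ne'
  have h1 : cfc (fun t : ℝ => t⁻¹) b * b = 1 := by
    rw [cfc_mul_self hb hc, ← cfc_one ℝ b]
    exact cfc_congr fun t ht => by simp [(hb0 t ht).ne']
  refine ⟨h1, ?_⟩
  rw [← h1]
  conv_lhs => enter [1]; rw [← cfc_id ℝ b]
  conv_rhs => enter [2]; rw [← cfc_id ℝ b]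
  exact cfc_commute_cfc _ _ b

/-- Joint convexity of `(x, b) ↦ τ (b⁻¹ x⋆ x)` on invertible positive `b`; it comes from the
positivity of `τ (b (x b⁻¹ - z c)⋆ (x b⁻¹ - z c))`. -/
theorem IsPosTrace.trace_inv_mul_star_mul_self_le (hτ : IsPosTrace τ) {x y b₁ b₂ : A}
    (hb₁ : IsSelfAdjoint b₁) (hb₂ : IsSelfAdjoint b₂) (h₁ : ∀ t ∈ spectrum ℝ b₁, 0 < t)
    (h₂ : ∀ t ∈ spectrum ℝ b₂, 0 < t) {s t : ℝ} (hs : 0 ≤ s) (ht : 0 ≤ t)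
    (hb : ∀ r ∈ spectrum ℝ (s • b₁ + t • b₂), 0 < r) :
    (τ (cfc (fun r : ℝ => r⁻¹) (s • b₁ + t • b₂) * (star (s • x + t • y) * (s • x + t • y)))).re ≤
      s * (τ (cfc (fun r : ℝ => r⁻¹) b₁ * (star x * x))).re
        + t * (τ (cfc (fun r : ℝ => r⁻¹) b₂ * (star y * y))).re := by
  set b := s • b₁ + t • b₂ with hbdef
  set z := s • x + t • y with hz
  have hbs : IsSelfAdjoint b := ((IsSelfAdjoint.all s).smul hb₁).add ((IsSelfAdjoint.all t).smul hb₂)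
  set c := cfc (fun r : ℝ => r⁻¹) b with hc
  have hcs : star c = c := (cfc_predicate (p := IsSelfAdjoint) _ b).star_eq
  have key {x' b' : A} (hb' : IsSelfAdjoint b') (h' : ∀ t ∈ spectrum ℝ b', 0 < t) :
      0 ≤ (τ (cfc (fun r : ℝ => r⁻¹) b' * (star x' * x'))).re - (τ (c * (star x' * z))).re
        - (τ (c * (star z * x'))).re + (τ (b' * (c * (star z * z) * c))).re := by
    set c' := cfc (fun r : ℝ => r⁻¹) b' with hc'
    have hcs' : star c' = c' := (cfc_predicate (p := IsSelfAdjoint) _ b').star_eq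
    obtain ⟨e1, e2⟩ := cfc_inv_mul_self hb' h'
    rw [← hc'] at e1 e2
    have h0 := hτ.re_cfc_mul_star_mul_self_nonneg (b := b') (h := id) (x' * c' - z * c)
      continuousOn_id fun t ht => (h' t ht).le
    rw [cfc_id ℝ b'] at h0
    have e : b' * (star (x' * c' - z * c) * (x' * c' - z * c)) =
        b' * c' * (star x' * x') * c' - b' * c' * (star x' * z) * c - b' * c * (star z * x') * c'
          + b' * (c * (star z * z) * c) := by
      simp only [star_sub, star_mul, hcs, hcs']
      noncomm_ring
    have e3 : τ (b' * c * (star z * x') * c') = τ (c * (star z * x')) := by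
      rw [hτ.map_mul_comm, ← mul_assoc, ← mul_assoc, ← mul_assoc, e1, one_mul, mul_assoc]
    rw [e, e2, one_mul, one_mul, map_add, map_sub, map_sub, e3, hτ.map_mul_comm _ c',
      hτ.map_mul_comm _ c] at h0
    simpa using h0
  have k1 := mul_le_mul_of_nonneg_left (key (x' := x) hb₁ h₁) hs
  have k2 := mul_le_mul_of_nonneg_left (key (x' := y) hb₂ h₂) ht
  have l1 : (τ (c * (star z * z))).re =
      s * (τ (c * (star x * z))).re + t * (τ (c * (star y * z))).re := by
    conv_lhs => rw [hz, star_add, star_smul, star_smul]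
    simp [add_mul, mul_add, ← hz]
  have l2 : (τ (c * (star z * z))).re =
      s * (τ (c * (star z * x))).re + t * (τ (c * (star z * y))).re := by
    conv_lhs => enter [1, 2, 2, 2]; rw [hz]
    simp [mul_add]
  have l3 : (τ (c * (star z * z))).re =
      s * (τ (b₁ * (c * (star z * z) * c))).re + t * (τ (b₂ * (c * (star z * z) * c))).re := by
    rw [← re_map_smul, ← re_map_smul, ← Complex.add_re, ← map_add, ← smul_mul_assoc,
      ← smul_mul_assoc, ← add_mul, ← hbdef, hτ.map_mul_comm c, ← mul_assoc, ← mul_assoc,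
      (cfc_inv_mul_self hbs hb).2, one_mul]
  linarith

theorem le_of_mem_spectrum_convexComb {b₁ b₂ : A} (hb₁ : IsSelfAdjoint b₁) (hb₂ : IsSelfAdjoint b₂)
    {r s t : ℝ} (h₁ : ∀ l ∈ spectrum ℝ b₁, r ≤ l) (h₂ : ∀ l ∈ spectrum ℝ b₂, r ≤ l)
    (hs : 0 ≤ s) (ht : 0 ≤ t) (hst : s + t = 1) : ∀ l ∈ spectrum ℝ (s • b₁ + t • b₂), r ≤ l := by
  let := CStarAlgebra.spectralOrder A
  have := CStarAlgebra.spectralOrderedRing A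
  rw [← algebraMap_le_iff_le_spectrum] at h₁ h₂ ⊢
  calc algebraMap ℝ A r = s • algebraMap ℝ A r + t • algebraMap ℝ A r := by
        rw [← add_smul, hst, one_smul]
    _ ≤ _ := add_le_add (smul_le_smul_of_nonneg_left h₁ hs) (smul_le_smul_of_nonneg_left h₂ ht)

/-- For `1/2 ≤ q < 1` the functional `τ ((x⋆ x) ^ q)` is the infimum over positive invertible `b`
of a jointly convex functional of `x` and `b`; this is the upper bound. -/
theorem IsPosTrace.trace_rpow_le_variational (hτ : IsPosTrace τ) {a b : A} (ha : IsSelfAdjoint a)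
    (ha0 : ∀ t ∈ spectrum ℝ a, 0 ≤ t) (hb : IsSelfAdjoint b) {r : ℝ} (hr : 0 < r)
    (hb0 : ∀ t ∈ spectrum ℝ b, r ≤ t) {q : ℝ} (hq0 : 0 ≤ q) (hq1 : q < 1) :
    (τ (cfc (fun t : ℝ => t ^ q) a)).re ≤ q * (τ (cfc (fun t : ℝ => t⁻¹) b * a)).re
      + (1 - q) * (τ (cfc (fun t : ℝ => t ^ (q / (1 - q))) b)).re := by
  have c0 : Continuous fun t : ℝ => t ^ q := Real.continuous_rpow_const hq0
  have c1 : Continuous fun t : ℝ => t ^ (q / (1 - q)) :=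
    Real.continuous_rpow_const (div_nonneg hq0 (sub_nonneg.2 hq1.le))
  have c2 : ContinuousOn (fun t : ℝ => t⁻¹) (Icc r (‖b‖ + r + 1)) :=
    continuousOn_inv₀.mono fun t ht => (hr.trans_le ht.1).ne'
  have hspec : spectrum ℝ b ⊆ Icc r (‖b‖ + r + 1) := fun t ht => ⟨hb0 t ht, by
    linarith [(spectrum_subset_Icc_of_nonneg (fun t ht => hr.le.trans (hb0 t ht)) ht).2]⟩
  have h := hτ.re_cfc_add_re_cfc_mul_le ha hb (by linarith [norm_nonneg b]) hspec
    (F := fun t => -1 * t ^ q) (u := fun t => (-(1 - q)) * t ^ (q / (1 - q)))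
    (v := fun t => (-q) * t⁻¹) (c0.const_mul _).continuousOn (c1.const_mul _).continuousOn
    (c2.const_mul _) fun s hs t ht => by
      linarith [rpow_le_variational hq0 hq1 (ha0 s hs) (hr.trans_le ht.1)]
  rw [cfc_const_mul _ _ b c1.continuousOn, cfc_const_mul _ _ b (c2.mono hspec),
    cfc_const_mul _ _ a c0.continuousOn, smul_mul_assoc, re_map_smul, re_map_smul, re_map_smul] at h
  linarith

/-- The variational functional at the almost optimal `b = (a + ε) ^ (1 - q)`. -/
theorem IsPosTrace.trace_variational_le (hτ : IsPosTrace τ) {a : A} (ha : IsSelfAdjoint a)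
    (ha0 : ∀ t ∈ spectrum ℝ a, 0 ≤ t) {q : ℝ} (hq0 : 0 < q) (hq1 : q < 1) {ε : ℝ} (hε : 0 < ε) :
    q * (τ (cfc (fun t : ℝ => t⁻¹) (cfc (fun t : ℝ => (t + ε) ^ (1 - q)) a) * a)).re
      + (1 - q) * (τ (cfc (fun t : ℝ => t ^ (q / (1 - q)))
        (cfc (fun t : ℝ => (t + ε) ^ (1 - q)) a))).re
      ≤ (τ (cfc (fun t : ℝ => t ^ q) a)).re + ε ^ q * (τ 1).re := by
  have h1q : 0 < 1 - q := sub_pos.2 hq1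
  have c0 : Continuous fun t : ℝ => t ^ q := Real.continuous_rpow_const hq0.le
  have c1 : Continuous fun t : ℝ => t ^ (q / (1 - q)) :=
    Real.continuous_rpow_const (div_nonneg hq0.le h1q.le)
  have c2 : Continuous fun t : ℝ => (t + ε) ^ (1 - q) :=
    (Real.continuous_rpow_const h1q.le).comp (continuous_id.add continuous_const)
  have hpos (t : ℝ) (ht : t ∈ spectrum ℝ a) : 0 < t + ε := by linarith [ha0 t ht]
  have c3 : ContinuousOn (fun t : ℝ => t⁻¹) ((fun t : ℝ => (t + ε) ^ (1 - q)) '' spectrum ℝ a) := by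
    refine continuousOn_inv₀.mono ?_
    rintro _ ⟨t, ht, rfl⟩
    exact (Real.rpow_pos_of_pos (hpos t ht) _).ne'
  have c4 : ContinuousOn (fun t : ℝ => ((t + ε) ^ (1 - q))⁻¹) (spectrum ℝ a) :=
    c3.comp c2.continuousOn (mapsTo_image _ _)
  rw [← cfc_comp' _ _ a c3 c2.continuousOn, ← cfc_comp' _ _ a c1.continuousOn c2.continuousOn,
    cfc_mul_self ha c4, ← re_map_smul, ← re_map_smul, ← re_map_smul, ← Complex.add_re, ← map_add,
    ← Complex.add_re, ← map_add, ← Algebra.algebraMap_eq_smul_one,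
    ← cfc_const_mul q (fun t : ℝ => ((t + ε) ^ (1 - q))⁻¹ * t) a (c4.mul (by fun_prop)),
    ← cfc_const_mul (1 - q) (fun t : ℝ => ((t + ε) ^ (1 - q)) ^ (q / (1 - q))) a
      (c1.comp c2).continuousOn,
    ← cfc_add_const _ _ a c0.continuousOn]
  rw [← cfc_add a (fun t : ℝ => q * (((t + ε) ^ (1 - q))⁻¹ * t))
    (fun t : ℝ => (1 - q) * ((t + ε) ^ (1 - q)) ^ (q / (1 - q)))
    ((c4.mul (by fun_prop)).const_mul _) ((c1.comp c2).const_mul _).continuousOn]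
  refine hτ.re_cfc_mono (((c4.mul (by fun_prop)).const_mul _).add
    ((c1.comp c2).const_mul _).continuousOn) (c0.add continuous_const).continuousOn
    fun t ht => ?_
  have h0 := ha0 t ht
  have h1 := hpos t ht
  have e1 : ((t + ε) ^ (1 - q)) ^ (q / (1 - q)) = (t + ε) ^ q := by
    rw [← Real.rpow_mul h1.le]; congr 1; field_simp
  have e2 : ((t + ε) ^ (1 - q))⁻¹ * t ≤ (t + ε) ^ q := by
    rw [← Real.rpow_neg h1.le, show -(1 - q) = q - 1 by ring, Real.rpow_sub_one h1.ne']
    have := Real.rpow_nonneg h1.le q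
    rw [div_mul_eq_mul_div, div_le_iff₀ h1]
    nlinarith
  have e3 : (t + ε) ^ q ≤ t ^ q + ε ^ q := Real.rpow_add_le_add_rpow h0 hε.le hq0.le hq1.le
  rw [e1]
  nlinarith

/-- Minkowski's inequality in convexity form. For `q ≥ 1` it is Jensen's inequality applied to
`z⋆ z ≤ s • x⋆ x + t • y⋆ y`; for `q < 1` it is read off from the variational formula. -/
theorem IsPosTrace.trace_star_mul_self_rpow_convex (hτ : IsPosTrace τ) {q : ℝ} (hq : 1 / 2 ≤ q)
    (x y : A) {s t : ℝ} (hs : 0 ≤ s) (ht : 0 ≤ t) (hst : s + t = 1) :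
    (τ (cfc (fun r : ℝ => r ^ q) (star (s • x + t • y) * (s • x + t • y)))).re ≤
      s * (τ (cfc (fun r : ℝ => r ^ q) (star x * x))).re
        + t * (τ (cfc (fun r : ℝ => r ^ q) (star y * y))).re := by
  have sa (w : A) : IsSelfAdjoint (star w * w) := .star_mul_self w
  have nn (w : A) : ∀ r ∈ spectrum ℝ (star w * w), 0 ≤ r := spectrum_star_mul_self_nonneg
  set z := s • x + t • y with hz
  rcases le_or_gt 1 q with hq1 | hq1
  · refine hτ.trace_rpow_le (sa x) (sa y) (sa z) (nn x) (nn y) (nn z) hs ht hst hq1 ?_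
    have e : s • (star x * x) + t • (star y * y) - star z * z =
        (s * t) • (star (x - y) * (x - y)) := by
      obtain rfl : t = 1 - s := by linarith
      rw [hz]
      simp only [star_add, star_smul, star_sub, star_trivial, add_mul, mul_add, sub_mul, mul_sub,
        smul_mul_assoc, mul_smul_comm, smul_smul, smul_add, smul_sub]
      module
    rw [e, mul_smul_comm, re_map_smul]
    exact mul_nonneg (mul_nonneg hs ht) (hτ.re_cfc_mul_star_mul_self_nonneg _
      (Real.continuous_rpow_const (by linarith)).continuousOn
      fun r hr => Real.rpow_nonneg (nn z r hr) _)
  · -- Near-optimal `b` for `x` and `y` are averaged, with an error `ε ^ q * τ 1` sent to `0`.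
    have hq0 : 0 < q := by linarith
    have h1q : 0 < 1 - q := sub_pos.2 hq1
    have hqq : 1 ≤ q / (1 - q) := (one_le_div h1q).2 (by linarith)
    have main (ε : ℝ) (hε : 0 < ε) :
        (τ (cfc (fun r : ℝ => r ^ q) (star z * z))).re ≤
          s * (τ (cfc (fun r : ℝ => r ^ q) (star x * x))).re
            + t * (τ (cfc (fun r : ℝ => r ^ q) (star y * y))).re + ε ^ q * (τ 1).re := by
      let β (w : A) : A := cfc (fun r : ℝ => (r + ε) ^ (1 - q)) (star w * w)
      have hβ (w : A) : IsSelfAdjoint (β w) := cfc_predicate _ _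
      have hε' : 0 < ε ^ (1 - q) := Real.rpow_pos_of_pos hε _
      have hβ0 (w : A) : ∀ l ∈ spectrum ℝ (β w), ε ^ (1 - q) ≤ l := by
        have c2 : Continuous fun t : ℝ => (t + ε) ^ (1 - q) :=
          (Real.continuous_rpow_const h1q.le).comp (continuous_id.add continuous_const)
        intro l hl
        rw [cfc_map_spectrum _ _ (sa w) c2.continuousOn] at hl
        obtain ⟨r, hr, rfl⟩ := hl
        exact Real.rpow_le_rpow hε.le (by linarith [nn w r hr]) h1q.le
      have hb : IsSelfAdjoint (s • β x + t • β y) :=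
        ((IsSelfAdjoint.all s).smul (hβ x)).add ((IsSelfAdjoint.all t).smul (hβ y))
      have hb0 := le_of_mem_spectrum_convexComb (hβ x) (hβ y) (hβ0 x) (hβ0 y) hs ht hst
      have i1 := hτ.trace_rpow_le_variational (sa z) (nn z) hb hε' hb0 hq0.le hq1
      have i2 := hτ.trace_inv_mul_star_mul_self_le (x := x) (y := y) (hβ x) (hβ y)
        (fun l hl => hε'.trans_le (hβ0 x l hl)) (fun l hl => hε'.trans_le (hβ0 y l hl)) hs ht
        (fun l hl => hε'.trans_le (hb0 l hl))
      have i3 := hτ.trace_rpow_le (hβ x) (hβ y) hb (fun l hl => hε'.le.trans (hβ0 x l hl))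
        (fun l hl => hε'.le.trans (hβ0 y l hl)) (fun l hl => hε'.le.trans (hb0 l hl)) hs ht hst hqq
        (by simp)
      have i4 := mul_le_mul_of_nonneg_left (hτ.trace_variational_le (sa x) (nn x) hq0 hq1 hε) hs
      have i5 := mul_le_mul_of_nonneg_left (hτ.trace_variational_le (sa y) (nn y) hq0 hq1 hε) ht
      have i6 := mul_le_mul_of_nonneg_left i2 hq0.le
      have i7 := mul_le_mul_of_nonneg_left i3 h1q.le
      obtain rfl : t = 1 - s := by linarith
      simp only [β] at *
      linarith
    have hlim : Tendsto (fun ε : ℝ => s * (τ (cfc (fun r : ℝ => r ^ q) (star x * x))).re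
        + t * (τ (cfc (fun r : ℝ => r ^ q) (star y * y))).re + ε ^ q * (τ 1).re) (𝓝[>] 0)
        (𝓝 (s * (τ (cfc (fun r : ℝ => r ^ q) (star x * x))).re
        + t * (τ (cfc (fun r : ℝ => r ^ q) (star y * y))).re)) := by
      have c0 : Continuous fun t : ℝ => t ^ q := Real.continuous_rpow_const hq0.le
      have := ((c0.tendsto 0).mul_const (τ 1).re).const_add
        (s * (τ (cfc (fun r : ℝ => r ^ q) (star x * x))).re
          + t * (τ (cfc (fun r : ℝ => r ^ q) (star y * y))).re)
      rw [Real.zero_rpow hq0.ne', zero_mul, add_zero] at this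
      exact this.mono_left nhdsWithin_le_nhds
    exact ge_of_tendsto hlim (eventually_nhdsWithin_of_forall main)

end Trace

/-! ### The canonical trace of a group von Neumann algebra -/

section GroupTrace

theorem star_toContinuousLinearMap_of_rightInverse {H : Type*} [NormedAddCommGroup H]
    [InnerProductSpace ℂ H] [CompleteSpace H] {U V : H →ₗᵢ[ℂ] H} (h : ∀ f, U (V f) = f) :
    star U.toContinuousLinearMap = V.toContinuousLinearMap := by
  have h1 : star U.toContinuousLinearMap * U.toContinuousLinearMap = 1 :=
    (ContinuousLinearMap.norm_map_iff_adjoint_comp_self _).1 U.norm_map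
  have h2 : U.toContinuousLinearMap * V.toContinuousLinearMap = 1 :=
    ContinuousLinearMap.ext h
  rw [← mul_one (star _), ← h2, ← mul_assoc, h1, one_mul]

theorem star_mul_self_unitary_conj {B : Type*} [Monoid B] [StarMul B] (U : unitary B) (x : B) :
    star (U * x * star (U : B)) * (U * x * star (U : B)) = U * (star x * x) * star (U : B) := by
  have h : star (U : B) * U = 1 := (Unitary.mem_iff.1 U.2).1
  simp only [star_mul, star_star, mul_assoc]
  rw [← mul_assoc (star (U : B)) U, h, one_mul]

theorem cfc_unitary_conj {B : Type*} [CStarAlgebra B] (U : unitary B) {a : B}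
    (ha : IsSelfAdjoint a) {f : ℝ → ℝ} (hf : Continuous f) :
    cfc f (U * a * star (U : B)) = U * cfc f a * star (U : B) := by
  refine (StarAlgHomClass.map_cfc (S := ℝ) (Unitary.conjStarAlgAut ℝ B U) f a hf.continuousOn ?_
    ha (ha.map (Unitary.conjStarAlgAut ℝ B U))).symm
  change Continuous fun x : B => U * x * star (U : B)
  fun_prop

section StarSubalgebra

variable {H : Type*} [NormedAddCommGroup H] [InnerProductSpace ℂ H] [CompleteSpace H]
  (S : StarSubalgebra ℂ (H →L[ℂ] H))

/-- The functional `x ↦ ⟨x ξ, ξ⟩` on an algebra of operators (Mathlib's inner product is linear in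
its second argument). -/
def vectorFunctional (ξ : H) : S →L[ℂ] ℂ :=
  (innerSL ℂ ξ).comp ((ContinuousLinearMap.apply ℂ H ξ).comp
    S.toSubalgebra.toSubmodule.subtypeL)

variable {S}

theorem vectorFunctional_apply (ξ : H) (x : S) :
    vectorFunctional S ξ x = inner ℂ ξ ((x : H →L[ℂ] H) ξ) := rfl

theorem inner_coe_star_left (x : S) (f g : H) :
    inner ℂ (((star x : S) : H →L[ℂ] H) f) g = inner ℂ f ((x : H →L[ℂ] H) g) :=
  ContinuousLinearMap.adjoint_inner_left _ _ _

theorem inner_coe_star_right (x : S) (f g : H) :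
    inner ℂ f (((star x : S) : H →L[ℂ] H) g) = inner ℂ ((x : H →L[ℂ] H) f) g :=
  ContinuousLinearMap.adjoint_inner_right _ _ _

theorem inner_coe_mul_apply (x y : S) (f g : H) :
    inner ℂ f (((x * y : S) : H →L[ℂ] H) g) =
      inner ℂ (((star x : S) : H →L[ℂ] H) f) ((y : H →L[ℂ] H) g) :=
  (inner_coe_star_left x f _).symm

theorem norm_eq_of_unitary_conj (U : unitary (H →L[ℂ] H)) {x y : S}
    (hy : (y : H →L[ℂ] H) = U * (x : H →L[ℂ] H) * star (U : H →L[ℂ] H)) : ‖y‖ = ‖x‖ := by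
  change ‖(y : H →L[ℂ] H)‖ = ‖(x : H →L[ℂ] H)‖
  rw [hy, ← Unitary.coe_star, CStarRing.norm_mul_coe_unitary, CStarRing.norm_coe_unitary_mul]

/-- Unitary conjugation commutes with the functional calculus of an algebra of operators, even when
it does not preserve that algebra. -/
theorem vectorFunctional_cfc_eq_of_unitary_conj [IsClosed (S : Set (H →L[ℂ] H))]
    (U : unitary (H →L[ℂ] H)) {ξ : H} (hξ : star (U : H →L[ℂ] H) ξ = ξ) {x y : S}
    (hy : (y : H →L[ℂ] H) = U * (x : H →L[ℂ] H) * star (U : H →L[ℂ] H)) {f : ℝ → ℝ}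
    (hf : Continuous f) :
    vectorFunctional S ξ (cfc f (star y * y)) = vectorFunctional S ξ (cfc f (star x * x)) := by
  have hcoe (z : S) : ((cfc f (star z * z) : S) : H →L[ℂ] H) =
      cfc f (star (z : H →L[ℂ] H) * (z : H →L[ℂ] H)) :=
    StarAlgHomClass.map_cfc S.subtype f (star z * z) hf.continuousOn
      continuous_subtype_val (.star_mul_self z) (.star_mul_self (z : H →L[ℂ] H))
  have h1 : cfc f (star (y : H →L[ℂ] H) * (y : H →L[ℂ] H)) =
      U * cfc f (star (x : H →L[ℂ] H) * (x : H →L[ℂ] H)) * star (U : H →L[ℂ] H) := by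
    rw [← cfc_unitary_conj U (.star_mul_self _) hf, hy, star_mul_self_unitary_conj]
  rw [vectorFunctional_apply, vectorFunctional_apply, hcoe, hcoe, h1]
  rw [mul_apply_eq_comp, mul_apply_eq_comp, hξ, ← ContinuousLinearMap.adjoint_inner_left, ← ContinuousLinearMap.star_eq_adjoint, hξ]

end StarSubalgebra

variable {G : Type} [Group G]

theorem star_leftReg (g : G) : star (leftReg g) = leftReg g⁻¹ := by
  refine star_toContinuousLinearMap_of_rightInverse (U := translate g) (V := translate g⁻¹)
    fun f => ?_
  ext h
  change (f : G → ℂ) (g⁻¹⁻¹ * (g⁻¹ * h)) = f h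
  simp

theorem memℓp_rightTranslate (g : G) (f : EllTwo G) :
    Memℓp (fun h : G => (f : G → ℂ) (h * g)) 2 := by
  have hf := lp.memℓp f
  rw [memℓp_gen_iff (by norm_num)] at hf ⊢
  exact hf.comp_injective (mul_left_injective g)

/-- Right translation `f ↦ f (· g)` on `ℓ²(G)`. -/
def rightTranslate (g : G) : EllTwo G →ₗᵢ[ℂ] EllTwo G where
  toFun f := ⟨fun h => (f : G → ℂ) (h * g), memℓp_rightTranslate g f⟩
  map_add' _ _ := rfl
  map_smul' _ _ := rfl
  norm_map' f := by
    rw [lp.norm_eq_tsum_rpow (by norm_num), lp.norm_eq_tsum_rpow (by norm_num)]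
    congr 1
    exact (Equiv.mulRight g).tsum_eq (fun h : G => ‖(f : G → ℂ) h‖ ^ (2 : ℝ≥0∞).toReal)

theorem rightTranslate_apply (g : G) (f : EllTwo G) (h : G) :
    rightTranslate g f h = f (h * g) := rfl

theorem groupVN_rightTranslate (x : GroupVN G) (g : G) (f : EllTwo G) :
    (x : EllTwo G →L[ℂ] EllTwo G) (rightTranslate g f) =
      rightTranslate g ((x : EllTwo G →L[ℂ] EllTwo G) f) := by
  have hcomm (k : G) : leftReg k * (rightTranslate g).toContinuousLinearMap =
      (rightTranslate g).toContinuousLinearMap * leftReg k := by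
    ext f h
    change (f : G → ℂ) (k⁻¹ * h * g) = f (k⁻¹ * (h * g))
    rw [mul_assoc]
  have hR : (rightTranslate g).toContinuousLinearMap ∈
      StarSubalgebra.centralizer ℂ (Set.range (leftReg (G := G))) := by
    rw [StarSubalgebra.mem_centralizer_iff]
    rintro _ ⟨k, rfl⟩
    exact ⟨hcomm k, by rw [star_leftReg]; exact hcomm k⁻¹⟩
  have hx : (x : EllTwo G →L[ℂ] EllTwo G) ∈ StarSubalgebra.centralizer ℂ
      (StarSubalgebra.centralizer ℂ (Set.range (leftReg (G := G))) :
        Set (EllTwo G →L[ℂ] EllTwo G)) := x.2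
  rw [StarSubalgebra.mem_centralizer_iff] at hx
  exact (congrArg (fun T : EllTwo G →L[ℂ] EllTwo G => T f) (hx _ hR).1).symm

theorem inner_deltaOne (f : EllTwo G) : inner ℂ deltaOne f = f 1 := by
  classical
  rw [deltaOne]
  simp [lp.inner_single_left]

theorem inner_rightTranslate_deltaOne (f : EllTwo G) (g : G) :
    inner ℂ f (rightTranslate g deltaOne) = star (f g⁻¹) := by
  classical
  have h : rightTranslate g deltaOne = lp.single (E := fun _ : G => ℂ) 2 g⁻¹ 1 := by
    ext h
    rw [rightTranslate_apply, deltaOne]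
    by_cases hg : h = g⁻¹
    · subst hg
      simp
    · have h1 : h * g ≠ 1 := fun h0 => hg (eq_inv_of_mul_eq_one_left h0)
      simp [h1, hg]
  rw [h]
  simp [lp.inner_single_right]

theorem star_apply_deltaOne (x : GroupVN G) (g : G) :
    ((star x : GroupVN G) : EllTwo G →L[ℂ] EllTwo G) deltaOne g =
      star ((x : EllTwo G →L[ℂ] EllTwo G) deltaOne g⁻¹) := by
  have h1 := rightTranslate_apply g
    (((star x : GroupVN G) : EllTwo G →L[ℂ] EllTwo G) deltaOne) 1
  rw [one_mul, ← inner_deltaOne, ← groupVN_rightTranslate] at h1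
  rw [← h1, ← inner_rightTranslate_deltaOne]
  exact inner_coe_star_right _ _ _

theorem tau_mul_eq_tsum (x y : GroupVN G) :
    tau (x * y) = ∑' g : G, (x : EllTwo G →L[ℂ] EllTwo G) deltaOne g⁻¹ *
      (y : EllTwo G →L[ℂ] EllTwo G) deltaOne g := by
  rw [tau, inner_coe_mul_apply, lp.inner_eq_tsum]
  refine tsum_congr fun g => ?_
  rw [star_apply_deltaOne]
  simp [mul_comm]

theorem tau_mul_comm (x y : GroupVN G) : tau (x * y) = tau (y * x) := by
  rw [tau_mul_eq_tsum, tau_mul_eq_tsum, ← (Equiv.inv G).tsum_eq]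
  refine tsum_congr fun g => ?_
  simp [mul_comm]

/-- The canonical trace as a bounded functional. -/
def tauCLM : GroupVN G →L[ℂ] ℂ :=
  vectorFunctional (groupVNAlg G).toStarSubalgebra deltaOne

theorem tauCLM_apply (x : GroupVN G) : tauCLM x = tau x := rfl

theorem isPosTrace_tauCLM : IsPosTrace (tauCLM : GroupVN G →L[ℂ] ℂ) where
  re_star_mul_self_nonneg y := by
    rw [tauCLM_apply, tau, inner_coe_mul_apply, star_star]
    exact inner_self_nonneg (𝕜 := ℂ)
  map_mul_comm := tau_mul_comm

end GroupTrace

/-! ### Properties of the noncommutative `L_p` norms -/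

section NormLp

variable {G : Type} [Group G] {p : ℝ≥0∞}

theorem normLp_top (x : GroupVN G) : normLp ∞ x = ‖x‖ := if_pos rfl

theorem normLp_of_ne_top (hp : p ≠ ∞) (x : GroupVN G) : normLp p x =
    (tauCLM (cfc (fun s : ℝ => s ^ (p.toReal / 2)) (star x * x))).re ^ (1 / p.toReal) := if_neg hp

theorem one_le_toReal_of_ne_top (hp1 : 1 ≤ p) (hp : p ≠ ∞) : 1 ≤ p.toReal := by
  simpa using ENNReal.toReal_mono hp hp1

theorem re_tau_rpow_nonneg {q : ℝ} (hq : 0 ≤ q) (x : GroupVN G) :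
    0 ≤ (tauCLM (cfc (fun s : ℝ => s ^ q) (star x * x))).re := by
  have h := isPosTrace_tauCLM.re_cfc_mul_star_mul_self_nonneg (b := star x * x) 1
    (Real.continuous_rpow_const hq).continuousOn
    fun t ht => Real.rpow_nonneg (spectrum_star_mul_self_nonneg t ht) q
  simpa only [star_one, mul_one] using h

theorem normLp_nonneg (p : ℝ≥0∞) (x : GroupVN G) : 0 ≤ normLp p x := by
  by_cases hp : p = ∞
  · rw [hp, normLp_top]
    exact norm_nonneg x
  · rw [normLp_of_ne_top hp]
    exact Real.rpow_nonneg (re_tau_rpow_nonneg (by positivity) x) _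

theorem normLp_smul (hp1 : 1 ≤ p) (c : ℂ) (x : GroupVN G) :
    normLp p (c • x) = ‖c‖ * normLp p x := by
  by_cases hp : p = ∞
  · rw [hp, normLp_top, normLp_top, norm_smul]
  · have h1 := one_le_toReal_of_ne_top hp1 hp
    have hq : 0 ≤ p.toReal / 2 := by linarith
    have c0 : Continuous fun s : ℝ => s ^ (p.toReal / 2) := Real.continuous_rpow_const hq
    have e : star (c • x) * (c • x) = (‖c‖ ^ 2 : ℝ) • (star x * x) := by
      rw [star_smul, smul_mul_smul_comm, ← Complex.coe_smul]
      congr 1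
      simpa using Complex.conj_mul' c
    have e2 : cfc (fun s : ℝ => s ^ (p.toReal / 2)) ((‖c‖ ^ 2 : ℝ) • (star x * x)) =
        (‖c‖ ^ p.toReal) • cfc (fun s : ℝ => s ^ (p.toReal / 2)) (star x * x) := by
      rw [← cfc_comp_smul _ _ _ c0.continuousOn, ← cfc_const_mul _ _ _ c0.continuousOn]
      refine cfc_congr fun t ht => ?_
      have ht0 : 0 ≤ t := spectrum_star_mul_self_nonneg t ht
      simp only [smul_eq_mul]
      rw [Real.mul_rpow (by positivity) ht0, ← Real.rpow_natCast, ← Real.rpow_mul (norm_nonneg c)]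
      congr 2
      push_cast
      ring
    rw [normLp_of_ne_top hp, normLp_of_ne_top hp, e, e2, re_map_smul,
      Real.mul_rpow (by positivity) (re_tau_rpow_nonneg hq x), ← Real.rpow_mul (norm_nonneg c),
      mul_one_div_cancel (by linarith), Real.rpow_one]

theorem convex_normLp_le (hp1 : 1 ≤ p) (C : ℝ) : Convex ℝ {x : GroupVN G | normLp p x ≤ C} := by
  by_cases hp : p = ∞
  · subst hp
    simp_rw [normLp_top]
    have h : {x : GroupVN G | ‖x‖ ≤ C} = Metric.closedBall 0 C :=
      Set.ext fun x => (mem_closedBall_zero_iff (a := x)).symm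
    rw [h]
    exact convex_closedBall (0 : GroupVN G) C
  · have h1 := one_le_toReal_of_ne_top hp1 hp
    have hq : 0 ≤ p.toReal / 2 := by linarith
    rcases lt_or_ge C 0 with hC | hC
    · intro x hx
      exact absurd ((normLp_nonneg p x).trans hx) hC.not_ge
    have key (x : GroupVN G) : normLp p x ≤ C ↔
        (tauCLM (cfc (fun s : ℝ => s ^ (p.toReal / 2)) (star x * x))).re ≤ C ^ p.toReal := by
      rw [normLp_of_ne_top hp, one_div,
        Real.rpow_inv_le_iff_of_pos (re_tau_rpow_nonneg hq x) hC (by linarith)]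
    intro x hx y hy s t hs ht hst
    rw [mem_ofPred_eq, key] at hx hy ⊢
    refine (isPosTrace_tauCLM.trace_star_mul_self_rpow_convex (by linarith) x y hs ht hst).trans ?_
    have h2 := mul_le_mul_of_nonneg_left hx hs
    have h3 := mul_le_mul_of_nonneg_left hy ht
    obtain rfl : t = 1 - s := by linarith
    linarith

/-- The triangle inequality for nonnegative combinations of elements of equal norm bound. -/
theorem normLp_sum_smul_le (hp1 : 1 ≤ p) {ι : Type*} (s : Finset ι) {w : ι → ℝ}
    (hw : ∀ i ∈ s, 0 ≤ w i) (hW : 0 < ∑ i ∈ s, w i) {x : ι → GroupVN G} {C : ℝ}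
    (hx : ∀ i ∈ s, normLp p (x i) ≤ C) :
    normLp p (∑ i ∈ s, (w i : ℂ) • x i : GroupVN G) ≤ (∑ i ∈ s, w i) * C := by
  set W := ∑ i ∈ s, w i with hWdef
  have h1 : (∑ i ∈ s, (w i / W) • x i : GroupVN G) ∈ {x : GroupVN G | normLp p x ≤ C} :=
    (convex_normLp_le (G := G) hp1 C).sum_mem (fun i hi => div_nonneg (hw i hi) hW.le)
      (by rw [← Finset.sum_div, ← hWdef, div_self hW.ne']) hx
  have h2 : (∑ i ∈ s, (w i : ℂ) • x i : GroupVN G) = (W : ℂ) • ∑ i ∈ s, (w i / W) • x i := by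
    rw [Finset.smul_sum]
    refine Finset.sum_congr rfl fun i _ => ?_
    rw [Complex.coe_smul, Complex.coe_smul, smul_smul, mul_div_cancel₀ _ hW.ne']
  rw [h2, normLp_smul hp1, Complex.norm_real, Real.norm_of_nonneg hW.le]
  exact mul_le_mul_of_nonneg_left h1 hW.le

/-- The `L_p` norms are invariant under conjugation by unitaries fixing `δ_e`. -/
theorem normLp_eq_of_conj {x y : GroupVN G} (U : unitary (EllTwo G →L[ℂ] EllTwo G))
    (hU : (star U : EllTwo G →L[ℂ] EllTwo G) deltaOne = deltaOne)
    (hy : (y : EllTwo G →L[ℂ] EllTwo G) = U * x * star (U : EllTwo G →L[ℂ] EllTwo G)) :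
    normLp p y = normLp p x := by
  by_cases hp : p = ∞
  · rw [hp, normLp_top, normLp_top]
    exact norm_eq_of_unitary_conj U hy
  · rw [normLp_of_ne_top hp, normLp_of_ne_top hp, tauCLM,
      vectorFunctional_cfc_eq_of_unitary_conj U hU hy
        (Real.continuous_rpow_const (by positivity))]

end NormLp

/-! ### Convex sequences as positive combinations of characters -/

section Fejer

/-- `IsPosCharSum ζ N M φ` says that on `{0, …, M}` the sequence `φ` is a combination of the
characters `j ↦ ζ ^ (l * j)`, `l < N`, with nonnegative weights. -/
def IsPosCharSum (ζ : ℂ) (N M : ℕ) (φ : ℕ → ℝ) : Prop :=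
  ∃ w : ℕ → ℝ, (∀ l, 0 ≤ w l) ∧
    ∀ j ≤ M, ∑ l ∈ Finset.range N, (w l : ℂ) * (ζ ^ l) ^ j = φ j

variable {ζ : ℂ} {N M : ℕ} {φ ψ : ℕ → ℝ}

theorem IsPosCharSum.add (hφ : IsPosCharSum ζ N M φ) (hψ : IsPosCharSum ζ N M ψ) :
    IsPosCharSum ζ N M (φ + ψ) := by
  obtain ⟨w, hw, h⟩ := hφ
  obtain ⟨v, hv, k⟩ := hψ
  refine ⟨w + v, fun l => add_nonneg (hw l) (hv l), fun j hj => ?_⟩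
  simp [add_mul, Finset.sum_add_distrib, h j hj, k j hj]

theorem IsPosCharSum.smul (hφ : IsPosCharSum ζ N M φ) {c : ℝ} (hc : 0 ≤ c) :
    IsPosCharSum ζ N M (c • φ) := by
  obtain ⟨w, hw, h⟩ := hφ
  refine ⟨c • w, fun l => mul_nonneg hc (hw l), fun j hj => ?_⟩
  simp [mul_assoc, ← Finset.mul_sum, h j hj]

theorem isPosCharSum_one (hN : 0 < N) : IsPosCharSum ζ N M 1 := by
  refine ⟨fun l => if l = 0 then 1 else 0, fun l => by positivity, fun j _ => ?_⟩
  rw [Finset.sum_eq_single 0] <;> simp +contextual [hN]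

theorem IsPosCharSum.sum {ι : Type*} (hN : 0 < N) (s : Finset ι) {f : ι → ℕ → ℝ}
    (h : ∀ i ∈ s, IsPosCharSum ζ N M (f i)) : IsPosCharSum ζ N M (∑ i ∈ s, f i) := by
  refine Finset.sum_induction _ (IsPosCharSum ζ N M) (fun _ _ => IsPosCharSum.add) ?_ h
  simpa using (isPosCharSum_one (ζ := ζ) (M := M) hN).smul le_rfl

theorem sum_range_ite_add_eq (m j : ℕ) :
    ∑ a ∈ Finset.range m, ∑ b ∈ Finset.range m, (if a + j = b then (1 : ℂ) else 0) =
      ((m - j : ℕ) : ℂ) := by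
  simp_rw [Finset.sum_ite_eq, Finset.mem_range]
  rw [Finset.sum_boole, show {a ∈ Finset.range m | a + j < m} = Finset.range (m - j) by
    ext a; simp only [Finset.mem_filter, Finset.mem_range]; omega, Finset.card_range]

/-- The weights are the Fejér kernel `|∑_{a < m} ζ ^ (l a)|² / N`, sampled at the `N`-th roots of unity. The bound
`2 M < N` prevents aliasing. -/
theorem isPosCharSum_triangle (hζ : IsPrimitiveRoot ζ N) (hN : 2 * M < N) {m : ℕ} (hm : m ≤ M) :
    IsPosCharSum ζ N M fun j => ((m - j : ℕ) : ℝ) := by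
  have hN0 : N ≠ 0 := by omega
  have hζ0 : ζ ≠ 0 := hζ.ne_zero hN0
  have hζn : ‖ζ‖ = 1 := hζ.norm'_eq_one hN0
  have orth (a b : ℕ) (ha : a < N) (hb : b < N) :
      ∑ l ∈ Finset.range N, (ζ ^ a / ζ ^ b) ^ l = if a = b then (N : ℂ) else 0 := by
    split_ifs with hab
    · subst hab
      simp [hζ0]
    · have h1 : ζ ^ a / ζ ^ b ≠ 1 := fun h => hab (hζ.pow_inj ha hb
        (by rwa [div_eq_one_iff_eq (pow_ne_zero _ hζ0)] at h))
      rw [geom_sum_eq h1, div_pow, ← pow_mul, ← pow_mul, mul_comm a, mul_comm b, pow_mul, pow_mul,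
        hζ.pow_eq_one]
      simp
  refine ⟨fun l => ‖∑ a ∈ Finset.range m, (ζ ^ l) ^ a‖ ^ 2 / N, fun l => by positivity,
    fun j hj => ?_⟩
  have hconj (l b : ℕ) : (starRingEnd ℂ) ((ζ ^ l) ^ b) = ((ζ ^ l) ^ b)⁻¹ :=
    (Complex.inv_eq_conj (by simp [hζn])).symm
  have hexp (l : ℕ) : ((‖∑ a ∈ Finset.range m, (ζ ^ l) ^ a‖ ^ 2 / N : ℝ) : ℂ) * (ζ ^ l) ^ j =
      (∑ a ∈ Finset.range m, ∑ b ∈ Finset.range m, (ζ ^ (a + j) / ζ ^ b) ^ l) / N := by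
    push_cast
    rw [← Complex.mul_conj', map_sum, Finset.sum_mul_sum, div_mul_eq_mul_div, Finset.sum_mul]
    congr 1
    refine Finset.sum_congr rfl fun a _ => ?_
    rw [Finset.sum_mul]
    refine Finset.sum_congr rfl fun b _ => ?_
    rw [hconj, div_pow, ← pow_mul, ← pow_mul, ← pow_mul, ← pow_mul, ← pow_mul, add_mul, pow_add,
      mul_comm a, mul_comm b, mul_comm j]
    ring
  simp_rw [hexp]
  rw [← Finset.sum_div, Finset.sum_comm]
  have h2 : ∀ a ∈ Finset.range m, ∑ l ∈ Finset.range N, ∑ b ∈ Finset.range m,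
      (ζ ^ (a + j) / ζ ^ b) ^ l =
      N * ∑ b ∈ Finset.range m, (if a + j = b then (1 : ℂ) else 0) := by
    intro a ha
    rw [Finset.sum_comm, Finset.mul_sum]
    refine Finset.sum_congr rfl fun b hb => ?_
    rw [Finset.mem_range] at ha hb
    rw [orth _ _ (by omega) (by omega)]
    simp
  rw [Finset.sum_congr rfl h2, ← Finset.mul_sum, sum_range_ite_add_eq,
    mul_div_cancel_left₀ _ (Nat.cast_ne_zero.2 hN0)]
  simp

/-- Abel summation by parts, applied twice. -/
theorem eq_sum_second_differences (ψ : ℕ → ℝ) (M : ℕ) : ∀ j ≤ M,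
    ψ j = ψ M + (ψ M - ψ (M + 1)) * ((M - j : ℕ) : ℝ) + ∑ m ∈ Finset.range M,
      (ψ m - 2 * ψ (m + 1) + ψ (m + 2)) * ((m + 1 - j : ℕ) : ℝ) := by
  induction M with
  | zero => simp
  | succ M ih =>
    intro j hj
    rcases Nat.le_succ_iff.1 hj with h | rfl
    · rw [Finset.sum_range_succ, ih j h, Nat.cast_sub h, Nat.cast_sub hj]
      push_cast
      ring
    · rw [Finset.sum_eq_zero fun m hm => ?_]
      · simp
      · rw [Finset.mem_range] at hm
        simp [Nat.sub_eq_zero_of_le (by omega : m + 1 ≤ M + 1)]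

theorem isPosCharSum_of_convex (hζ : IsPrimitiveRoot ζ N) (hN : 2 * M < N) (h0 : ∀ m, 0 ≤ ψ m)
    (h1 : ∀ m, ψ (m + 1) ≤ ψ m) (h2 : ∀ m, 2 * ψ (m + 1) ≤ ψ m + ψ (m + 2)) :
    IsPosCharSum ζ N M ψ := by
  have hN0 : 0 < N := by omega
  have h := (((isPosCharSum_one (ζ := ζ) (M := M) hN0).smul (h0 M)).add
    ((isPosCharSum_triangle hζ hN le_rfl).smul (sub_nonneg.2 (h1 M)))).add
    (IsPosCharSum.sum hN0 (Finset.range M) fun m hm =>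
      (isPosCharSum_triangle hζ hN (by rw [Finset.mem_range] at hm; omega : m + 1 ≤ M)).smul
        (by linarith [h2 m] : 0 ≤ ψ m - 2 * ψ (m + 1) + ψ (m + 2)))
  obtain ⟨w, hw, hs⟩ := h
  refine ⟨w, hw, fun j hj => ?_⟩
  rw [hs j hj, eq_sum_second_differences ψ M j hj]
  simp

end Fejer

/-! ### Rotations -/

section Rotation

variable {G : Type} [Group G]

theorem norm_circle_mul (z : Circle) (c : ℂ) : ‖(z : ℂ) * c‖ = ‖c‖ := by
  rw [norm_mul, Circle.norm_coe, one_mul]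

theorem memℓp_phase (χ : G →* Circle) (f : EllTwo G) :
    Memℓp (fun h : G => (χ h : ℂ) * (f : G → ℂ) h) 2 := by
  have hf := lp.memℓp f
  rw [memℓp_gen_iff (by norm_num)] at hf ⊢
  simpa only [norm_circle_mul] using hf

/-- Multiplication by a character of `G` as a linear isometry of `ℓ²(G)`. -/
def phase (χ : G →* Circle) : EllTwo G →ₗᵢ[ℂ] EllTwo G where
  toFun f := ⟨fun h => (χ h : ℂ) * (f : G → ℂ) h, memℓp_phase χ f⟩
  map_add' f g := by
    ext h
    exact mul_add _ _ _
  map_smul' c f := by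
    ext h
    exact mul_left_comm _ _ _
  norm_map' f := by
    rw [lp.norm_eq_tsum_rpow (by norm_num), lp.norm_eq_tsum_rpow (by norm_num)]
    change (∑' h, ‖(χ h : ℂ) * f h‖ ^ (2 : ℝ≥0∞).toReal) ^ _ = _
    simp only [norm_circle_mul]

theorem phase_apply (χ : G →* Circle) (f : EllTwo G) (h : G) :
    phase χ f h = (χ h : ℂ) * f h := rfl

theorem phase_phase_inv (χ : G →* Circle) (f : EllTwo G) : phase χ (phase χ⁻¹ f) = f := by
  ext h
  rw [phase_apply, phase_apply]
  simp

theorem star_phase (χ : G →* Circle) : star (phase χ).toContinuousLinearMap =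
    (phase χ⁻¹).toContinuousLinearMap :=
  star_toContinuousLinearMap_of_rightInverse (phase_phase_inv χ)

/-- `phase` as a unitary operator. -/
def phaseUnitary (χ : G →* Circle) : unitary (EllTwo G →L[ℂ] EllTwo G) :=
  ⟨(phase χ).toContinuousLinearMap, by
    rw [Unitary.mem_iff, star_phase]
    refine ⟨ContinuousLinearMap.ext fun f => ?_, ContinuousLinearMap.ext (phase_phase_inv χ)⟩
    have := phase_phase_inv χ⁻¹ f
    rwa [inv_inv] at this⟩

theorem star_phaseUnitary_deltaOne (χ : G →* Circle) :
    star (phaseUnitary χ : EllTwo G →L[ℂ] EllTwo G) deltaOne = deltaOne := by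
  classical
  change star (phase χ).toContinuousLinearMap deltaOne = deltaOne
  rw [star_phase]
  ext h
  change phase χ⁻¹ deltaOne h = _
  rw [phase_apply, deltaOne]
  by_cases hh : h = 1
  · simp [hh]
  · simp [hh]

theorem phaseUnitary_conj_leftReg (χ : G →* Circle) (g : G) :
    (phaseUnitary χ : EllTwo G →L[ℂ] EllTwo G) * leftReg g *
      star (phaseUnitary χ : EllTwo G →L[ℂ] EllTwo G) = (χ g : ℂ) • leftReg g := by
  change (phase χ).toContinuousLinearMap * leftReg g * star (phase χ).toContinuousLinearMap = _
  rw [star_phase]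
  ext f h
  change (χ h : ℂ) * ((χ⁻¹ (g⁻¹ * h) : Circle) * f (g⁻¹ * h)) = (χ g : ℂ) * f (g⁻¹ * h)
  rw [← mul_assoc, ← Circle.coe_mul]
  simp

end Rotation

/-! ### Degree multipliers on holomorphic polynomials -/

variable {n : ℕ}

section FreeGroup

theorem snd_eq_true_of_mem_toWord {g : FreeGroup (Fin n)} (hg : g ∈ posSemigroup n) :
    ∀ a ∈ g.toWord, a.2 = true := by
  refine Submonoid.closure_induction (motive := fun g _ => ∀ a ∈ FreeGroup.toWord g, a.2 = true)
    ?_ ?_ ?_ hg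
  · rintro _ ⟨i, rfl⟩
    simp
  · simp
  · intro x y _ _ hx hy a ha
    rcases List.mem_append.1 ((FreeGroup.toWord_mul_sublist x y).subset ha) with h | h
    exacts [hx a h, hy a h]

/-- There is no cancellation in a product of positive words. -/
theorem norm_mul_of_mem_posSemigroup {x y : FreeGroup (Fin n)} (hx : x ∈ posSemigroup n)
    (hy : y ∈ posSemigroup n) : (x * y).norm = x.norm + y.norm := by
  have h : FreeGroup.IsReduced (x.toWord ++ y.toWord) := by
    have hall : ∀ a ∈ x.toWord ++ y.toWord, a.2 = true := by
      intro a ha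
      rcases List.mem_append.1 ha with h | h
      exacts [snd_eq_true_of_mem_toWord hx a h, snd_eq_true_of_mem_toWord hy a h]
    refine List.Pairwise.isChain (List.pairwise_iff_forall_sublist.2 fun {a b} hab _ => ?_)
    rw [hall a (hab.subset (by simp)), hall b (hab.subset (by simp))]
  rw [FreeGroup.norm, FreeGroup.toWord_mul, h.reduce_eq, List.length_append, FreeGroup.norm,
    FreeGroup.norm]

theorem lift_const_of_mem_posSemigroup {M : Type*} [Group M] (z : M) {g : FreeGroup (Fin n)}
    (hg : g ∈ posSemigroup n) : FreeGroup.lift (fun _ : Fin n => z) g = z ^ g.norm := by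
  refine Submonoid.closure_induction
    (motive := fun g _ => FreeGroup.lift (fun _ : Fin n => z) g = z ^ g.norm) ?_ ?_ ?_ hg
  · rintro _ ⟨i, rfl⟩
    simp
  · simp
  · intro x y hx hy h1 h2
    rw [map_mul, h1, h2, norm_mul_of_mem_posSemigroup hx hy, pow_add]

end FreeGroup

/-- The Fourier multiplier `∑ x_g λ_g ↦ ∑ φ(|g|) x_g λ_g`. -/
def degMul (φ : ℕ → ℂ) : Poly (FreeGroup (Fin n)) →ₗ[ℂ] Poly (FreeGroup (Fin n)) :=
  polyBasis.constr ℂ fun g => φ g.norm • polyBasis g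

theorem gen_eq_degMul : (gen : Poly (FreeGroup (Fin n)) →ₗ[ℂ] _) = degMul fun k => (k : ℂ) := rfl

theorem heat_eq_degMul (t : ℝ) : (heat t : Poly (FreeGroup (Fin n)) →ₗ[ℂ] _) =
    degMul fun k => (Real.exp (-t * k) : ℂ) := rfl

theorem degMul_polyBasis (φ : ℕ → ℂ) (g : FreeGroup (Fin n)) :
    degMul φ (polyBasis g) = φ g.norm • polyBasis g :=
  polyBasis.constr_basis ℂ _ g

theorem repr_degMul (φ : ℕ → ℂ) (x : Poly (FreeGroup (Fin n))) (g : FreeGroup (Fin n)) :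
    polyBasis.repr (degMul φ x) g = φ g.norm * polyBasis.repr x g := by
  have h : polyBasis.coord g ∘ₗ degMul φ = φ g.norm • polyBasis.coord g := by
    refine polyBasis.ext fun h => ?_
    simp only [LinearMap.comp_apply, degMul_polyBasis, map_smul, LinearMap.smul_apply,
      Module.Basis.coord_apply, Module.Basis.repr_self, smul_eq_mul]
    by_cases hg : h = g
    · rw [hg]
    · simp [Finsupp.single_eq_of_ne' hg]
  exact LinearMap.congr_fun h x

theorem degMul_congr {φ ψ : ℕ → ℂ} {x : Poly (FreeGroup (Fin n))}
    (h : ∀ g ∈ (polyBasis.repr x).support, φ g.norm = ψ g.norm) : degMul φ x = degMul ψ x := by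
  refine polyBasis.repr.injective (Finsupp.ext fun g => ?_)
  rw [repr_degMul, repr_degMul]
  by_cases hg : g ∈ (polyBasis.repr x).support
  · rw [h g hg]
  · rw [Finsupp.notMem_support_iff.1 hg, mul_zero, mul_zero]

theorem degMul_degMul (φ ψ : ℕ → ℂ) (x : Poly (FreeGroup (Fin n))) :
    degMul φ (degMul ψ x) = degMul (fun k => φ k * ψ k) x := by
  refine polyBasis.repr.injective (Finsupp.ext fun g => ?_)
  rw [repr_degMul, repr_degMul, repr_degMul, mul_assoc]

theorem degMul_one (x : Poly (FreeGroup (Fin n))) : degMul (fun _ => 1) x = x := by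
  refine polyBasis.repr.injective (Finsupp.ext fun g => ?_)
  rw [repr_degMul, one_mul]

theorem degMul_const_mul (c : ℂ) (φ : ℕ → ℂ) (x : Poly (FreeGroup (Fin n))) :
    degMul (fun k => c * φ k) x = c • degMul φ x := by
  refine polyBasis.repr.injective (Finsupp.ext fun g => ?_)
  rw [repr_degMul, map_smul, Finsupp.smul_apply, repr_degMul, smul_eq_mul, mul_assoc]

theorem degMul_sum {ι : Type*} (s : Finset ι) (φ : ι → ℕ → ℂ) (x : Poly (FreeGroup (Fin n))) :
    degMul (fun k => ∑ i ∈ s, φ i k) x = ∑ i ∈ s, degMul (φ i) x := by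
  have h : (degMul (fun k => ∑ i ∈ s, φ i k) : Poly (FreeGroup (Fin n)) →ₗ[ℂ] _) =
      ∑ i ∈ s, degMul (φ i) := by
    refine polyBasis.ext fun g => ?_
    simp only [LinearMap.sum_apply, degMul_polyBasis, Finset.sum_smul]
  rw [h, LinearMap.sum_apply]

theorem support_repr_degMul_subset (φ : ℕ → ℂ) (x : Poly (FreeGroup (Fin n))) :
    (polyBasis.repr (degMul φ x)).support ⊆ (polyBasis.repr x).support := by
  intro g hg
  rw [Finsupp.mem_support_iff, repr_degMul] at hg
  exact Finsupp.mem_support_iff.2 (right_ne_zero_of_mul hg)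

theorem degMul_mem_span {s : Set (FreeGroup (Fin n))} (φ : ℕ → ℂ) {x : Poly (FreeGroup (Fin n))}
    (hx : x ∈ Submodule.span ℂ (polyBasis '' s)) :
    degMul φ x ∈ Submodule.span ℂ (polyBasis '' s) := by
  rw [Module.Basis.mem_span_image] at hx ⊢
  exact (Finset.coe_subset.2 (support_repr_degMul_subset φ x)).trans hx

/-- On holomorphic polynomials the rotation `∑ x_g λ_g ↦ ∑ z^|g| x_g λ_g` is implemented by a
unitary, as `g ↦ z ^ |g|` extends from positive words to a character of the free group. -/
theorem coe_degMul_pow_of_holomorphic (z : Circle) {x : Poly (FreeGroup (Fin n))}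
    (hx : x ∈ holomorphic n) :
    (((degMul (fun k => (z : ℂ) ^ k) x : Poly (FreeGroup (Fin n))) :
      GroupVN (FreeGroup (Fin n))) : EllTwo (FreeGroup (Fin n)) →L[ℂ] EllTwo (FreeGroup (Fin n))) =
    phaseUnitary (FreeGroup.lift fun _ : Fin n => z) *
      ((x : GroupVN (FreeGroup (Fin n))) :
        EllTwo (FreeGroup (Fin n)) →L[ℂ] EllTwo (FreeGroup (Fin n))) *
      star (phaseUnitary (FreeGroup.lift fun _ : Fin n => z) :
        EllTwo (FreeGroup (Fin n)) →L[ℂ] EllTwo (FreeGroup (Fin n))) := by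
  induction hx using Submodule.span_induction with
  | mem y hy =>
    obtain ⟨g, hg, rfl⟩ := hy
    rw [degMul_polyBasis]
    have h := phaseUnitary_conj_leftReg (FreeGroup.lift fun _ : Fin n => z) g
    rw [lift_const_of_mem_posSemigroup z hg, Circle.coe_pow] at h
    change (z : ℂ) ^ g.norm • ((polyBasis g : GroupVN (FreeGroup (Fin n))) :
      EllTwo (FreeGroup (Fin n)) →L[ℂ] EllTwo (FreeGroup (Fin n))) = _
    rw [coe_polyBasis]
    exact h.symm
  | zero => simp
  | add y₁ y₂ _ _ h₁ h₂ =>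
    rw [map_add]
    push_cast
    rw [h₁, h₂, mul_add, add_mul]
  | smul c y _ h =>
    rw [map_smul]
    change c • (_ : EllTwo (FreeGroup (Fin n)) →L[ℂ] EllTwo (FreeGroup (Fin n))) = _ * (c • _) * _
    rw [h, mul_smul_comm, smul_mul_assoc]

theorem coe_sum_smul {G : Type} [Group G] {ι : Type*} (s : Finset ι) (w : ι → ℂ) (y : ι → Poly G) :
    ((∑ i ∈ s, w i • y i : Poly G) : GroupVN G) = ∑ i ∈ s, w i • (y i : GroupVN G) := by
  rw [Submodule.coe_sum]
  rfl

theorem normLp_coe_smul {G : Type} [Group G] {p : ℝ≥0∞} (hp1 : 1 ≤ p) (c : ℂ) (x : Poly G) :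
    normLp p ((c • x : Poly G) : GroupVN G) = ‖c‖ * normLp p (x : GroupVN G) :=
  normLp_smul hp1 c _

theorem normLp_degMul_pow {p : ℝ≥0∞} {z : ℂ} (hz : ‖z‖ = 1) {x : Poly (FreeGroup (Fin n))}
    (hx : x ∈ holomorphic n) :
    normLp p (degMul (fun k => z ^ k) x : GroupVN (FreeGroup (Fin n))) =
      normLp p (x : GroupVN (FreeGroup (Fin n))) := by
  obtain ⟨z, rfl⟩ : ∃ z' : Circle, (z' : ℂ) = z := ⟨⟨z, mem_sphere_zero_iff_norm.2 hz⟩, rfl⟩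
  exact normLp_eq_of_conj (phaseUnitary (FreeGroup.lift fun _ : Fin n => z))
    (star_phaseUnitary_deltaOne _) (coe_degMul_pow_of_holomorphic z hx)

/-- A positive combination of rotations, with phases, is bounded by its total weight. -/
theorem normLp_degMul_sum_le {p : ℝ≥0∞} (hp1 : 1 ≤ p) {ι : Type*} (s : Finset ι) {w : ι → ℝ}
    (hw : ∀ i ∈ s, 0 ≤ w i) (hW : 0 < ∑ i ∈ s, w i) {c z : ι → ℂ} (hc : ∀ i, ‖c i‖ = 1)
    (hz : ∀ i, ‖z i‖ = 1) {x : Poly (FreeGroup (Fin n))} (hx : x ∈ holomorphic n) :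
    normLp p (degMul (fun k => ∑ i ∈ s, (w i : ℂ) * (c i * z i ^ k)) x :
      GroupVN (FreeGroup (Fin n))) ≤
      (∑ i ∈ s, w i) * normLp p (x : GroupVN (FreeGroup (Fin n))) := by
  have hi (i : ι) : normLp p (degMul (fun k => c i * z i ^ k) x : GroupVN (FreeGroup (Fin n))) =
      normLp p (x : GroupVN (FreeGroup (Fin n))) := by
    rw [degMul_const_mul, normLp_coe_smul hp1, hc, one_mul, normLp_degMul_pow (hz i) hx]
  have e : degMul (fun k => ∑ i ∈ s, (w i : ℂ) * (c i * z i ^ k)) x =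
      ∑ i ∈ s, (w i : ℂ) • degMul (fun k => c i * z i ^ k) x := by
    rw [degMul_sum]
    exact Finset.sum_congr rfl fun i _ => degMul_const_mul _ _ x
  rw [e, coe_sum_smul]
  exact normLp_sum_smul_le hp1 s hw hW fun i _ => (hi i).le

/-- A convex sequence: nonnegative, decreasing, with nonnegative second differences. -/
structure IsConvexSeq (ψ : ℕ → ℝ) : Prop where
  nonneg : ∀ m, 0 ≤ ψ m
  succ_le : ∀ m, ψ (m + 1) ≤ ψ m
  two_mul_le : ∀ m, 2 * ψ (m + 1) ≤ ψ m + ψ (m + 2)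

theorem sum_weights_eq {ζ : ℂ} {s : Finset ℕ} {w : ℕ → ℝ} {ψ : ℕ → ℝ} {M : ℕ}
    (h : ∀ j ≤ M, ∑ l ∈ s, (w l : ℂ) * (ζ ^ l) ^ j = ψ j) : ∑ l ∈ s, w l = ψ 0 := by
  have h0 := h 0 (Nat.zero_le M)
  simp only [pow_zero, mul_one] at h0
  rw [← Complex.ofReal_sum] at h0
  exact Complex.ofReal_injective h0

/-- If `x` has degrees at least `d`, the multiplier `ψ(k - d)` is a positive combination of
rotations on `x`. -/
theorem normLp_degMul_le_of_tail {p : ℝ≥0∞} (hp1 : 1 ≤ p) {ψ : ℕ → ℝ} (hψ : IsConvexSeq ψ)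
    (hψ0 : 0 < ψ 0) {d : ℕ} {x : Poly (FreeGroup (Fin n))} (hx : x ∈ holomorphic n)
    (hxd : x ∈ tailSpace n d) :
    normLp p (degMul (fun k => (ψ (k - d) : ℂ)) x : GroupVN (FreeGroup (Fin n))) ≤
      ψ 0 * normLp p (x : GroupVN (FreeGroup (Fin n))) := by
  rw [tailSpace, Module.Basis.mem_span_image] at hxd
  -- The representation of `ψ` is needed only up to the largest degree of `x`.
  obtain ⟨M, hM⟩ : ∃ M, ∀ g ∈ (polyBasis.repr x).support, g.norm ≤ M :=
    ⟨_, fun g hg => Finset.le_sup (f := FreeGroup.norm) hg⟩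
  obtain ⟨ζ, hζ⟩ : ∃ ζ : ℂ, IsPrimitiveRoot ζ (2 * M + 1) :=
    ⟨_, Complex.isPrimitiveRoot_exp (2 * M + 1) (by omega)⟩
  have hζn : ‖ζ‖ = 1 := hζ.norm'_eq_one (by omega)
  obtain ⟨w, hw, h⟩ := isPosCharSum_of_convex hζ (by omega : 2 * M < 2 * M + 1) hψ.nonneg
    hψ.succ_le hψ.two_mul_le
  have hsum := sum_weights_eq h
  have key := normLp_degMul_sum_le hp1 (Finset.range (2 * M + 1)) (fun l _ => hw l)
    (by rwa [hsum]) (c := fun l => ((ζ ^ l) ^ d)⁻¹) (z := fun l => ζ ^ l) (by simp [hζn])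
    (by simp [hζn]) hx
  rw [hsum] at key
  refine le_of_eq_of_le (congrArg _ (congrArg _ (degMul_congr fun g hg => ?_))) key
  have hd : d ≤ g.norm := hxd hg
  have hgM : g.norm ≤ M := hM g hg
  rw [← h (g.norm - d) (by omega)]
  refine Finset.sum_congr rfl fun l _ => ?_
  rw [pow_sub₀ _ (pow_ne_zero _ (hζ.ne_zero (by omega))) hd, mul_comm ((ζ ^ l) ^ g.norm)]

/-- If `x` has degrees at most `d`, the multiplier `ψ(d - k)` is a positive combination of
rotations on `x`. -/
theorem normLp_degMul_le_of_low {p : ℝ≥0∞} (hp1 : 1 ≤ p) {ψ : ℕ → ℝ} (hψ : IsConvexSeq ψ)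
    (hψ0 : 0 < ψ 0) {d : ℕ} {x : Poly (FreeGroup (Fin n))} (hx : x ∈ holomorphic n)
    (hxd : x ∈ lowSpace n d) :
    normLp p (degMul (fun k => (ψ (d - k) : ℂ)) x : GroupVN (FreeGroup (Fin n))) ≤
      ψ 0 * normLp p (x : GroupVN (FreeGroup (Fin n))) := by
  rw [lowSpace, Module.Basis.mem_span_image] at hxd
  obtain ⟨ζ, hζ⟩ : ∃ ζ : ℂ, IsPrimitiveRoot ζ (2 * d + 1) :=
    ⟨_, Complex.isPrimitiveRoot_exp (2 * d + 1) (by omega)⟩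
  have hζn : ‖ζ‖ = 1 := hζ.norm'_eq_one (by omega)
  obtain ⟨w, hw, h⟩ := isPosCharSum_of_convex hζ (by omega : 2 * d < 2 * d + 1) hψ.nonneg
    hψ.succ_le hψ.two_mul_le
  have hsum := sum_weights_eq h
  have key := normLp_degMul_sum_le hp1 (Finset.range (2 * d + 1)) (fun l _ => hw l)
    (by rwa [hsum]) (c := fun l => (ζ ^ l) ^ d) (z := fun l => (ζ ^ l)⁻¹) (by simp [hζn])
    (by simp [hζn]) hx
  rw [hsum] at key
  refine le_of_eq_of_le (congrArg _ (congrArg _ (degMul_congr fun g hg => ?_))) key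
  have hd : g.norm ≤ d := hxd hg
  rw [← h (d - g.norm) (by omega)]
  refine Finset.sum_congr rfl fun l _ => ?_
  rw [pow_sub₀ _ (pow_ne_zero _ (hζ.ne_zero (by omega))) hd, inv_pow]

/-! ### Heat semigroup and generator -/

theorem isConvexSeq_exp {t : ℝ} (ht : 0 ≤ t) : IsConvexSeq fun j => Real.exp (-t * j) := by
  have hr : Real.exp (-t) ≤ 1 := Real.exp_le_one_iff.2 (by linarith)
  have h1 (m : ℕ) : Real.exp (-t * (m + 1 : ℕ)) = Real.exp (-t * m) * Real.exp (-t) := by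
    rw [← Real.exp_add]; push_cast; ring_nf
  have h0 (m : ℕ) : 0 < Real.exp (-t * m) := Real.exp_pos _
  refine ⟨fun m => (h0 m).le, fun m => ?_, fun m => ?_⟩
  · rw [h1]
    exact mul_le_of_le_one_right (h0 m).le hr
  · rw [h1 (m + 1), h1]
    nlinarith [mul_nonneg (h0 m).le (sq_nonneg (1 - Real.exp (-t)))]

theorem isConvexSeq_inv {d : ℕ} (hd : 1 ≤ d) : IsConvexSeq fun j => ((d + j : ℕ) : ℝ)⁻¹ := by
  have h0 (m : ℕ) : (0 : ℝ) < ((d + m : ℕ) : ℝ) := by exact_mod_cast (by omega : 0 < d + m)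
  refine ⟨fun m => (inv_pos.2 (h0 m)).le, fun m => ?_, fun m => ?_⟩
  · exact inv_anti₀ (h0 m) (by exact_mod_cast (by omega : d + m ≤ d + (m + 1)))
  · have h := h0 m
    rw [show ((d + (m + 1) : ℕ) : ℝ) = (d + m : ℕ) + 1 by push_cast; ring,
      show ((d + (m + 2) : ℕ) : ℝ) = (d + m : ℕ) + 2 by push_cast; ring]
    generalize ((d + m : ℕ) : ℝ) = r at h
    have e : r⁻¹ + (r + 2)⁻¹ - 2 * (r + 1)⁻¹ = 2 / (r * (r + 1) * (r + 2)) := by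
      field_simp
      ring
    have : 0 ≤ 2 / (r * (r + 1) * (r + 2)) := by positivity
    linarith

theorem isConvexSeq_triangle (d : ℕ) : IsConvexSeq fun j => ((d - j : ℕ) : ℝ) := by
  refine ⟨fun m => by positivity, fun m => ?_, fun m => ?_⟩
  · exact_mod_cast (by omega : d - (m + 1) ≤ d - m)
  · exact_mod_cast (by omega : 2 * (d - (m + 1)) ≤ (d - m) + (d - (m + 2)))

variable {p : ℝ≥0∞} {d : ℕ} {x : Poly (FreeGroup (Fin n))}

theorem normLp_heat_le_of_tail (hp1 : 1 ≤ p) (hx : x ∈ holomorphic n) (hxd : x ∈ tailSpace n d)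
    {t : ℝ} (ht : 0 ≤ t) :
    normLp p (heat t x : GroupVN (FreeGroup (Fin n))) ≤
      Real.exp (-t * d) * normLp p (x : GroupVN (FreeGroup (Fin n))) := by
  have h := normLp_degMul_le_of_tail hp1 (isConvexSeq_exp ht) (Real.exp_pos _) hx hxd
  have e : heat t x = (Real.exp (-t * d) : ℂ) •
      degMul (fun k => (Real.exp (-t * (k - d : ℕ)) : ℂ)) x := by
    rw [heat_eq_degMul, ← degMul_const_mul]
    rw [tailSpace, Module.Basis.mem_span_image] at hxd
    refine degMul_congr fun g hg => ?_
    rw [← Complex.ofReal_mul, ← Real.exp_add, Nat.cast_sub (hxd hg)]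
    ring_nf
  rw [e, Submodule.coe_smul, normLp_smul hp1, Complex.norm_real,
    Real.norm_of_nonneg (Real.exp_pos _).le]
  refine mul_le_mul_of_nonneg_left (h.trans_eq ?_) (Real.exp_pos _).le
  simp

/-- Applying the multiplier `1 / k` to `gen x` recovers `x`. -/
theorem le_normLp_gen_of_tail (hp1 : 1 ≤ p) (hd : 1 ≤ d) (hx : x ∈ holomorphic n)
    (hxd : x ∈ tailSpace n d) :
    (d : ℝ) * normLp p (x : GroupVN (FreeGroup (Fin n))) ≤
      normLp p (gen x : GroupVN (FreeGroup (Fin n))) := by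
  have hd0 : (0 : ℝ) < d := by exact_mod_cast hd
  have h := normLp_degMul_le_of_tail hp1 (isConvexSeq_inv hd) (by simpa using hd0)
    (degMul_mem_span (fun k => (k : ℂ)) hx) (degMul_mem_span (fun k => (k : ℂ)) hxd)
  have e : degMul (fun k => (((d + (k - d) : ℕ) : ℝ)⁻¹ : ℝ)) (degMul (fun k => (k : ℂ)) x) = x := by
    rw [degMul_degMul]
    conv_rhs => rw [← degMul_one x]
    rw [tailSpace, Module.Basis.mem_span_image] at hxd
    refine degMul_congr fun g hg => ?_
    have hg : d ≤ g.norm := hxd hg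
    have hg0 : (g.norm : ℂ) ≠ 0 := by exact_mod_cast (by omega : g.norm ≠ 0)
    rw [Nat.add_sub_cancel' hg]
    push_cast
    exact inv_mul_cancel₀ hg0
  rw [e, ← gen_eq_degMul, add_zero] at h
  rwa [← le_inv_mul_iff₀ hd0]

theorem normLp_gen_le_of_low (hp1 : 1 ≤ p) (hd : 1 ≤ d) (hx : x ∈ holomorphic n)
    (hxd : x ∈ lowSpace n d) :
    normLp p (gen x : GroupVN (FreeGroup (Fin n))) ≤
      (d : ℝ) * normLp p (x : GroupVN (FreeGroup (Fin n))) := by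
  have hd0 : (0 : ℝ) < d := by exact_mod_cast hd
  have h := normLp_degMul_le_of_low hp1 (isConvexSeq_triangle d) (by simpa using hd0) hx hxd
  have e : gen x = degMul (fun k => (((d - (d - k) : ℕ) : ℝ) : ℂ)) x := by
    rw [gen_eq_degMul]
    rw [lowSpace, Module.Basis.mem_span_image] at hxd
    refine degMul_congr fun g hg => ?_
    rw [Nat.sub_sub_self (hxd hg), Complex.ofReal_natCast]
  rwa [e]

/-- Applying the multiplier `e^{-t(d - k)}` to `heat t x` gives `e^{-td} x`. -/
theorem le_normLp_heat_of_low (hp1 : 1 ≤ p) (hx : x ∈ holomorphic n) (hxd : x ∈ lowSpace n d)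
    {t : ℝ} (ht : 0 ≤ t) :
    Real.exp (-t * d) * normLp p (x : GroupVN (FreeGroup (Fin n))) ≤
      normLp p (heat t x : GroupVN (FreeGroup (Fin n))) := by
  have h := normLp_degMul_le_of_low hp1 (isConvexSeq_exp ht) (Real.exp_pos _)
    (degMul_mem_span (fun k => (Real.exp (-t * k) : ℂ)) hx)
    (degMul_mem_span (fun k => (Real.exp (-t * k) : ℂ)) hxd)
  have e : degMul (fun k => (Real.exp (-t * (d - k : ℕ)) : ℂ))
      (degMul (fun k => (Real.exp (-t * k) : ℂ)) x) = (Real.exp (-t * d) : ℂ) • x := by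
    rw [degMul_degMul]
    conv_rhs => rw [← degMul_one x, ← degMul_const_mul]
    rw [lowSpace, Module.Basis.mem_span_image] at hxd
    refine degMul_congr fun g hg => ?_
    rw [← Complex.ofReal_mul, ← Real.exp_add, Nat.cast_sub (hxd hg), mul_one]
    ring_nf
  rw [e, ← heat_eq_degMul, Submodule.coe_smul, normLp_smul hp1, Complex.norm_real,
    Real.norm_of_nonneg (Real.exp_pos _).le] at h
  refine h.trans_eq ?_
  simp

theorem normLp_lam {G : Type} [Group G] (p : ℝ≥0∞) (g : G) : normLp p (lam g) = 1 := by
  have h1 : star (lam g) * lam g = 1 := by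
    refine Subtype.ext ?_
    change star (leftReg g) * leftReg g = 1
    exact (ContinuousLinearMap.norm_map_iff_adjoint_comp_self _).1 (translate g).norm_map
  by_cases hp : p = ∞
  · have : Nontrivial (GroupVN G) := ⟨0, lam g, fun h => linearIndependent_lam.ne_zero g h.symm⟩
    rw [hp, normLp_top, ← mul_self_inj (norm_nonneg _) zero_le_one, ← CStarRing.norm_star_mul_self,
      h1, norm_one, mul_one]
  · rw [normLp_of_ne_top hp, h1, cfc_apply_one, Real.one_rpow, map_one]
    have h2 : (tauCLM (1 : GroupVN G)) = 1 := by
      rw [tauCLM_apply]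
      change inner ℂ (deltaOne : EllTwo G) deltaOne = 1
      rw [inner_deltaOne]
      classical
      simp [deltaOne]
    rw [h2, Complex.one_re, Real.one_rpow]

end FreeHeat
end

theorem theorem1 (n d : ℕ) (hn : 1 ≤ n) (hd : 1 ≤ d) :
    (∀ p : ENNReal, 1 ≤ p → ∀ x ∈ FreeHeat.holomorphic n,
      (x ∈ FreeHeat.tailSpace n d →
        (∀ t : ℝ, 0 ≤ t →
          FreeHeat.normLp p (FreeHeat.heat t x : FreeHeat.GroupVN (FreeGroup (Fin n))) ≤
            Real.exp (-t * d) * FreeHeat.normLp p (x : FreeHeat.GroupVN (FreeGroup (Fin n)))) ∧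
        (d : ℝ) * FreeHeat.normLp p (x : FreeHeat.GroupVN (FreeGroup (Fin n))) ≤
          FreeHeat.normLp p (FreeHeat.gen x : FreeHeat.GroupVN (FreeGroup (Fin n)))) ∧
      (x ∈ FreeHeat.lowSpace n d →
        FreeHeat.normLp p (FreeHeat.gen x : FreeHeat.GroupVN (FreeGroup (Fin n))) ≤
          (d : ℝ) * FreeHeat.normLp p (x : FreeHeat.GroupVN (FreeGroup (Fin n))) ∧
        ∀ t : ℝ, 0 ≤ t →
          Real.exp (-t * d) * FreeHeat.normLp p (x : FreeHeat.GroupVN (FreeGroup (Fin n))) ≤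
            FreeHeat.normLp p (FreeHeat.heat t x : FreeHeat.GroupVN (FreeGroup (Fin n))))) ∧
    -- sharpness: a single nonzero holomorphic polynomial attains equality in all four bounds
    (∃ x ∈ FreeHeat.holomorphic n, x ∈ FreeHeat.tailSpace n d ∧ x ∈ FreeHeat.lowSpace n d ∧
      ∀ p : ENNReal, 1 ≤ p →
        0 < FreeHeat.normLp p (x : FreeHeat.GroupVN (FreeGroup (Fin n))) ∧
        (∀ t : ℝ, 0 ≤ t →
          FreeHeat.normLp p (FreeHeat.heat t x : FreeHeat.GroupVN (FreeGroup (Fin n))) =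
            Real.exp (-t * d) * FreeHeat.normLp p (x : FreeHeat.GroupVN (FreeGroup (Fin n)))) ∧
        FreeHeat.normLp p (FreeHeat.gen x : FreeHeat.GroupVN (FreeGroup (Fin n))) =
          (d : ℝ) * FreeHeat.normLp p (x : FreeHeat.GroupVN (FreeGroup (Fin n)))) := by
  refine ⟨fun p hp1 x hx => ⟨fun hxd => ⟨fun t ht => FreeHeat.normLp_heat_le_of_tail hp1 hx hxd ht,
    FreeHeat.le_normLp_gen_of_tail hp1 hd hx hxd⟩, fun hxd =>
    ⟨FreeHeat.normLp_gen_le_of_low hp1 hd hx hxd,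
      fun t ht => FreeHeat.le_normLp_heat_of_low hp1 hx hxd ht⟩⟩, ?_⟩
  -- Equality holds at the single word `g₁ ^ d`.
  set g : FreeGroup (Fin n) := FreeGroup.of ⟨0, hn⟩ ^ d with hg
  have hgn : g.norm = d := FreeGroup.norm_of_pow _ _
  have hgpos : g ∈ FreeHeat.posSemigroup n :=
    pow_mem (Submonoid.subset_closure (Set.mem_range_self _)) d
  have mem {s : Set (FreeGroup (Fin n))} (hs : g ∈ s) :
      FreeHeat.polyBasis g ∈ Submodule.span ℂ (FreeHeat.polyBasis '' s) :=
    Submodule.subset_span (Set.mem_image_of_mem _ hs)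
  have h1 : FreeHeat.polyBasis g ∈ FreeHeat.holomorphic n := mem hgpos
  have h2 : FreeHeat.polyBasis g ∈ FreeHeat.tailSpace n d := mem hgn.ge
  have h3 : FreeHeat.polyBasis g ∈ FreeHeat.lowSpace n d := mem hgn.le
  refine ⟨FreeHeat.polyBasis g, h1, h2, h3, fun p hp1 => ⟨?_, fun t ht => ?_, ?_⟩⟩
  · rw [FreeHeat.coe_polyBasis, FreeHeat.normLp_lam]
    exact one_pos
  · exact le_antisymm (FreeHeat.normLp_heat_le_of_tail hp1 h1 h2 ht)
      (FreeHeat.le_normLp_heat_of_low hp1 h1 h3 ht)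
  · exact le_antisymm (FreeHeat.normLp_gen_le_of_low hp1 hd h1 h3)
      (FreeHeat.le_normLp_gen_of_tail hp1 hd h1 h2)
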